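/- All tensor products are Hilbert space tensor products, $\Sigma$ is the tensor flip, and leg numbering notation is used. Let $\mathcal H\neq0$ and $\mathcal L$ be Hilbert spaces and let $(\mathbb W,\mathbb U,\mathbb V,\mathbb F)$ be a (top-)braided multiplicative unitary. That is, $\mathbb W\in\mathcal U(\mathcal H\otimes\mathcal H)$, $\mathbb U\in\mathcal U(\mathcal L\otimes\mathcal H)$, $\mathbb V\in\mathcal U(\mathcal H\otimes\mathcal L)$, $\mathbb F\in\mathcal U(\mathcal L\otimes\mathcal L)$ are unitaries with $\mathbb W_{23}\mathbb W_{12}=\mathbb W_{12}\mathbb W_{13}\mathbb W_{23}$, $\mathbb W_{23}\mathbb U_{12}=\mathbb U_{12}\mathbb U_{13}\mathbb W_{23}$, $\mathbb V_{23}\mathbb W_{12}=\mathbb W_{12}\mathbb V_{13}\mathbb V_{23}$, $\mathbb V_{12}\mathbb W_{13}\mathbb U_{23}=\mathbb U_{23}\mathbb W_{13}\mathbb V_{12}$ (on $\mathcal H\otimes\mathcal L\otimes\mathcal H$), $\mathbb U_{13}\mathbb U_{23}\mathbb F_{12}=\mathbb F_{12}\mathbb U_{13}\mathbb U_{23}$,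 $\mathbb V_{13}\mathbb V_{12}\mathbb F_{23}=\mathbb F_{23}\mathbb V_{13}\mathbb V_{12}$, and $\mathbb F_{23}\mathbb F_{12}=\mathbb F_{12}\,c^{\mathcal L}_{23}\,\mathbb F_{12}\,(c^{\mathcal L}_{23})^{-1}\,\mathbb F_{23}$. Here, for a right representation $S\in\mathcal U(K\otimes\mathcal H)$ of $\mathbb W$ (so $\mathbb W_{23}S_{12}=S_{12}S_{13}\mathbb W_{23}$), the braiding operator is $c^{K}=Z\Sigma\colon\mathcal L\otimes K\to K\otimes\mathcal L$ for the unique unitary $Z\in\mathcal U(K\otimes\mathcal L)$ with $Z_{13}=\mathbb V_{23}S_{12}^*\mathbb V_{23}^*S_{12}$ on $K\otimes\mathcal H\otimes\mathcal L$, and $c^{\mathcal L}$ belongs to $S=\mathbb U$; it is assumed that $c^{\mathcal L}$ is defined, that is, that this $Z$ exists for $S=\mathbb U$. A representation of $(\mathbb W,\mathbb U,\mathbb V,\mathbb F)$ is a triple $(K,S,T)$ with a Hilbert space $K$, a right representation $S\in\mathcal U(K\otimes\mathcal H)$ of $\mathbb W$ for which the braiding operator $c^K$ is defined, and $T\in\mathcal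 U(K\otimes\mathcal L)$ with $S_{13}\mathbb U_{23}T_{12}=T_{12}S_{13}\mathbb U_{23}$ and $\mathbb F_{23}T_{12}=T_{12}\,c^{\mathcal L}_{23}\,T_{12}\,(c^{\mathcal L}_{23})^{-1}\,\mathbb F_{23}$. Arrows $(K_1,S_1,T_1)\to(K_2,S_2,T_2)$ are the bounded operators $a\colon K_1\to K_2$ with $(a\otimes1)S_1=S_2(a\otimes1)$ and $(a\otimes1)T_1=T_2(a\otimes1)$. Put $\tau(K)=(K,1,1)$ and $\tau(x)=\tau(K)$ for $x=(K,S,T)$, and $$(K_1,S_1,T_1)\otimes(K_2,S_2,T_2)=\bigl(K_1\otimes K_2,\ (S_1)_{13}(S_2)_{23},\ T_1\top T_2\bigr),\qquad T_1\top T_2=c^{K_2}_{23}\,(T_1)_{12}\,(c^{K_2}_{23})^{-1}\,(T_2)_{23}.$$ Then the following hold. (a) The representations of $(\mathbb W,\mathbb U,\mathbb V,\mathbb F)$ form a Hilbert space tensor category. That is: the spaces of arrows are weakly closed linear spaces of operators, contain the identities and are closed under composition and adjoints; two representations on the same Hilbert space between which the identity operator is an arrow are equal; the $\tau(K)$ are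 representations, and every bounded operator $K_1\to K_2$ is an arrow $\tau(K_1)\to\tau(K_2)$; tensor products of representations are representations, tensor products of arrows are arrows, $\tau(K_1)\otimes\tau(K_2)=\tau(K_1\otimes K_2)$; the associators of Hilbert spaces and the unit transformations $K\cong\mathbb C\otimes K$, $K\cong K\otimes\mathbb C$ (with $\mathbb C$ carrying $\tau(\mathbb C)$) are arrows; and if $a\otimes\mathrm{id}$ is an arrow $x_1\otimes y\to x_2\otimes y$ or $\mathrm{id}\otimes a$ is an arrow $y\otimes x_1\to y\otimes x_2$ for some representation $y$ on a nonzero Hilbert space, then $a$ is an arrow $x_1\to x_2$. (b) The triple $\rho=(\mathcal H,\mathbb W,1)\otimes(\mathcal L,\mathbb U,\mathbb F)=(\mathcal H\otimes\mathcal L,\ \mathbb W_{13}\mathbb U_{23},\ 1\top\mathbb F)$ is a representation, and $\rho$ together with the unitaries $$A^x=S_{12}\,(T\top 1_{\mathcal H})\in\mathcal U(K\otimes\mathcal H\otimes\mathcal L),\qquad x=(K,S,T),$$ where $T\top1_{\mathcal H}$ is the second unitary of $x\otimes(\mathcal H,\mathbb W,1)$, is a natural right absorber (a regular object in the sense of Pinzari–Roberts):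 each $A^x$ is an arrow $x\otimes\rho\to\tau(x)\otimes\rho$; $(a\otimes\mathrm{id}_\rho)A^{x_1}=A^{x_2}(a\otimes\mathrm{id}_\rho)$ for every arrow $a\colon x_1\to x_2$; and $A^{x_1\otimes x_2}=A^{x_1}_{13}A^{x_2}_{23}$ for all representations $x_1,x_2$. -/

import Mathlib

open scoped TensorProduct InnerProductSpace
open UniformSpace

universe u

/-- The Hilbert space tensor product: the completion of the algebraic tensor product with the
inner product determined by `⟪x ⊗ y, x' ⊗ y'⟫ = ⟪x, x'⟫ ⟪y, y'⟫`. -/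
def HTensor (E F : Type*) [NormedAddCommGroup E] [InnerProductSpace ℂ E]
    [NormedAddCommGroup F] [InnerProductSpace ℂ F] : Type _ :=
  Completion (E ⊗[ℂ] F)

namespace HTensor

noncomputable section

variable {E F G E' F' : Type*}
  [NormedAddCommGroup E] [InnerProductSpace ℂ E]
  [NormedAddCommGroup F] [InnerProductSpace ℂ F]
  [NormedAddCommGroup G] [InnerProductSpace ℂ G]
  [NormedAddCommGroup E'] [InnerProductSpace ℂ E']
  [NormedAddCommGroup F'] [InnerProductSpace ℂ F']

instance : NormedAddCommGroup (HTensor E F) :=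
  inferInstanceAs (NormedAddCommGroup (Completion (E ⊗[ℂ] F)))

instance : InnerProductSpace ℂ (HTensor E F) :=
  inferInstanceAs (InnerProductSpace ℂ (Completion (E ⊗[ℂ] F)))

instance : CompleteSpace (HTensor E F) :=
  inferInstanceAs (CompleteSpace (Completion (E ⊗[ℂ] F)))

variable (E F) in
/-- The canonical isometric embedding of the algebraic tensor product. -/
def incl : E ⊗[ℂ] F →ₗᵢ[ℂ] HTensor E F :=
  (Completion.toComplₗᵢ : E ⊗[ℂ] F →ₗᵢ[ℂ] Completion (E ⊗[ℂ] F))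

theorem denseRange_incl : DenseRange (incl E F) :=
  Completion.denseRange_coe

/-- The tensor product `f ⊗ g` of two unitaries. -/
def congr (f : E ≃ₗᵢ[ℂ] E') (g : F ≃ₗᵢ[ℂ] F') : HTensor E F ≃ₗᵢ[ℂ] HTensor E' F' :=
  (TensorProduct.congrIsometry f g).toLinearEquiv.extendOfIsometry
    (incl E F).toLinearMap (incl E' F').toLinearMap denseRange_incl denseRange_incl
    (fun x => by
      rw [LinearIsometry.coe_toLinearMap, LinearIsometry.coe_toLinearMap,
        LinearIsometry.norm_map, LinearIsometry.norm_map]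
      exact (TensorProduct.congrIsometry f g).norm_map x)

variable (E F) in
/-- The tensor flip `Σ (x ⊗ y) = y ⊗ x`. -/
def flip : HTensor E F ≃ₗᵢ[ℂ] HTensor F E :=
  (TensorProduct.commIsometry ℂ E F).toLinearEquiv.extendOfIsometry
    (incl E F).toLinearMap (incl F E).toLinearMap denseRange_incl denseRange_incl
    (fun x => by
      rw [LinearIsometry.coe_toLinearMap, LinearIsometry.coe_toLinearMap,
        LinearIsometry.norm_map, LinearIsometry.norm_map]
      exact (TensorProduct.commIsometry ℂ E F).norm_map x)

theorem denseRange_mapIsometry (f : E →ₗᵢ[ℂ] E') (g : F →ₗᵢ[ℂ] F')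
    (hf : DenseRange f) (hg : DenseRange g) :
    DenseRange ((incl E' F').comp
      (TensorProduct.mapIsometry f g)).toLinearMap := by
  have h : DenseRange (TensorProduct.mapIsometry f g) := by
    intro z
    change z ∈ closure (Set.range (TensorProduct.mapIsometry f g).toLinearMap)
    rw [← LinearMap.coe_range, ← Submodule.topologicalClosure_coe, SetLike.mem_coe]
    induction z with
    | zero => exact zero_mem _
    | add x y hx hy => exact add_mem hx hy
    | tmul x y =>
      refine (hf.prodMap hg).induction_on
        (p := fun q : E' × F' => q.1 ⊗ₜ[ℂ] q.2 ∈
          (LinearMap.range (TensorProduct.mapIsometry f g).toLinearMap).topologicalClosure)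
        (x, y) ?_ ?_
      · exact (Submodule.isClosed_topologicalClosure _).preimage TensorProduct.continuous_tmul
      · rintro ⟨a, b⟩
        exact Submodule.le_topologicalClosure _ ⟨a ⊗ₜ b, by simp⟩
  exact denseRange_incl.comp h (incl E' F').continuous

variable (E F G) in
/-- The associator `(x ⊗ y) ⊗ z ↦ x ⊗ (y ⊗ z)`. -/
def assoc : HTensor (HTensor E F) G ≃ₗᵢ[ℂ] HTensor E (HTensor F G) :=
  (TensorProduct.assocIsometry ℂ E F G).toLinearEquiv.extendOfIsometry
    ((incl (HTensor E F) G).comp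
      (TensorProduct.mapIsometry (incl E F) LinearIsometry.id)).toLinearMap
    ((incl E (HTensor F G)).comp
      (TensorProduct.mapIsometry LinearIsometry.id (incl F G))).toLinearMap
    (denseRange_mapIsometry _ _ denseRange_incl Function.surjective_id.denseRange)
    (denseRange_mapIsometry _ _ Function.surjective_id.denseRange denseRange_incl)
    (fun x => by
      rw [LinearIsometry.coe_toLinearMap, LinearIsometry.coe_toLinearMap,
        LinearIsometry.norm_map, LinearIsometry.norm_map]
      exact (TensorProduct.assocIsometry ℂ E F G).norm_map x)

theorem norm_sq_sum_tmul {ι : Type*} [Fintype ι] (c : ι → E) {f : ι → F}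
    (hf : Orthonormal ℂ f) : ‖∑ i, c i ⊗ₜ[ℂ] f i‖ ^ 2 = ∑ i, ‖c i‖ ^ 2 := by
  classical
  have h : (inner ℂ (∑ i, c i ⊗ₜ[ℂ] f i) (∑ i, c i ⊗ₜ[ℂ] f i) : ℂ)
      = ∑ i, inner ℂ (c i) (c i) := by
    simp only [sum_inner, inner_sum, TensorProduct.inner_tmul]
    refine Finset.sum_congr rfl fun i _ => ?_
    simp_rw [orthonormal_iff_ite.mp hf]
    simp
  have h' := (inner_self_eq_norm_sq_to_K (𝕜 := ℂ) (∑ i, c i ⊗ₜ[ℂ] f i)).symm.trans h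
  simp_rw [inner_self_eq_norm_sq_to_K] at h'
  exact_mod_cast h'

theorem norm_rTensor_le (a : E →L[ℂ] E') (x : E ⊗[ℂ] F) :
    ‖LinearMap.rTensor F a.toLinearMap x‖ ≤ ‖a‖ * ‖x‖ := by
  obtain ⟨E₀, F₀, -, iF, hz⟩ :=
    TensorProduct.exists_finite_submodule_of_setFinite {x} (Set.finite_singleton x)
  obtain ⟨y, rfl⟩ := Set.singleton_subset_iff.mp hz
  let f := stdOrthonormalBasis ℂ F₀
  obtain ⟨b, rfl⟩ := TensorProduct.eq_repr_basis_right f.toBasis y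
  have h1 : TensorProduct.mapIncl E₀ F₀ (b.sum fun i m => m ⊗ₜ[ℂ] f.toBasis i)
      = ∑ i, ((b i : E₀) : E) ⊗ₜ[ℂ] (f i : F) := by
    rw [Finsupp.sum_fintype _ _ (by simp)]
    simp [TensorProduct.mapIncl]
  rw [h1, map_sum]
  simp only [LinearMap.rTensor_tmul]
  refine le_of_sq_le_sq ?_ (by positivity)
  have hf : Orthonormal ℂ (fun i => (f i : F)) :=
    f.orthonormal.comp_linearIsometry F₀.subtypeₗᵢ
  rw [mul_pow, norm_sq_sum_tmul _ hf, norm_sq_sum_tmul _ hf, Finset.mul_sum]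
  refine Finset.sum_le_sum fun i _ => ?_
  rw [← mul_pow]
  exact pow_le_pow_left₀ (norm_nonneg _) (a.le_opNorm _) 2

theorem norm_map_le (a : E →L[ℂ] E') (b : F →L[ℂ] F') (x : E ⊗[ℂ] F) :
    ‖TensorProduct.map a.toLinearMap b.toLinearMap x‖ ≤ ‖a‖ * ‖b‖ * ‖x‖ := by
  have h : TensorProduct.map a.toLinearMap b.toLinearMap x =
      LinearMap.rTensor F' a.toLinearMap (TensorProduct.comm ℂ F' E
        (LinearMap.rTensor E b.toLinearMap (TensorProduct.comm ℂ E F x))) := by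
    induction x with
    | zero => simp
    | add x y hx hy => simp only [map_add, hx, hy]
    | tmul x y => simp
  rw [h, mul_assoc]
  refine (norm_rTensor_le _ _).trans (mul_le_mul_of_nonneg_left ?_ (norm_nonneg _))
  rw [TensorProduct.norm_comm]
  exact (norm_rTensor_le _ _).trans (by rw [TensorProduct.norm_comm])

/-- The tensor product `a ⊗ b` of two bounded operators. -/
def map (a : E →L[ℂ] E') (b : F →L[ℂ] F') : HTensor E F →L[ℂ] HTensor E' F' :=
  (((incl E' F').toLinearMap ∘ₗ TensorProduct.map a.toLinearMap b.toLinearMap)).extendOfNorm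
    (incl E F).toLinearMap

/-- The elementary tensor `x ⊗ y` in the Hilbert space tensor product. -/
def tmul (x : E) (y : F) : HTensor E F := incl E F (x ⊗ₜ[ℂ] y)

theorem map_tmul (a : E →L[ℂ] E') (b : F →L[ℂ] F') (x : E) (y : F) :
    map a b (tmul x y) = tmul (a x) (b y) :=
  LinearMap.extendOfNorm_eq (e := (incl E F).toLinearMap) denseRange_incl
    ⟨‖a‖ * ‖b‖, fun z => by
      simpa only [LinearMap.comp_apply, LinearIsometry.coe_toLinearMap,
        LinearIsometry.norm_map] using norm_map_le a b z⟩ (x ⊗ₜ[ℂ] y)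

theorem congr_tmul (f : E ≃ₗᵢ[ℂ] E') (g : F ≃ₗᵢ[ℂ] F') (x : E) (y : F) :
    congr f g (tmul x y) = tmul (f x) (g y) :=
  LinearEquiv.extendOfIsometry_eq _ _ _ _ _ _ (x ⊗ₜ[ℂ] y)

theorem flip_tmul (x : E) (y : F) : flip E F (tmul x y) = tmul y x :=
  LinearEquiv.extendOfIsometry_eq _ _ _ _ _ _ (x ⊗ₜ[ℂ] y)

theorem assoc_tmul (x : E) (y : F) (z : G) :
    assoc E F G (tmul (tmul x y) z) = tmul x (tmul y z) :=
  LinearEquiv.extendOfIsometry_eq _ _ _ _ _ _ ((x ⊗ₜ[ℂ] y) ⊗ₜ[ℂ] z)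

end

end HTensor

namespace HTensor

noncomputable section

variable {A B C A' B' C' : Type*}
  [NormedAddCommGroup A] [InnerProductSpace ℂ A]
  [NormedAddCommGroup B] [InnerProductSpace ℂ B]
  [NormedAddCommGroup C] [InnerProductSpace ℂ C]
  [NormedAddCommGroup A'] [InnerProductSpace ℂ A']
  [NormedAddCommGroup B'] [InnerProductSpace ℂ B']
  [NormedAddCommGroup C'] [InnerProductSpace ℂ C']

variable (C) in
/-- Leg numbering: `T₁₂ = T ⊗ 1` on `A ⊗ B ⊗ C`. -/
def leg12 (T : HTensor A B ≃ₗᵢ[ℂ] HTensor A' B') :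
    HTensor (HTensor A B) C ≃ₗᵢ[ℂ] HTensor (HTensor A' B') C :=
  congr T (LinearIsometryEquiv.refl ℂ C)

variable (A) in
/-- Leg numbering: `T₂₃ = 1 ⊗ T` on `A ⊗ B ⊗ C`. -/
def leg23 (T : HTensor B C ≃ₗᵢ[ℂ] HTensor B' C') :
    HTensor (HTensor A B) C ≃ₗᵢ[ℂ] HTensor (HTensor A B') C' :=
  ((assoc A B C).trans (congr (LinearIsometryEquiv.refl ℂ A) T)).trans (assoc A B' C').symm

variable (B) in
/-- Leg numbering: `T₁₃ = Σ₂₃ T₁₂ Σ₂₃` on `A ⊗ B ⊗ C`. -/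
def leg13 (T : HTensor A C ≃ₗᵢ[ℂ] HTensor A' C') :
    HTensor (HTensor A B) C ≃ₗᵢ[ℂ] HTensor (HTensor A' B) C' :=
  ((leg23 A (flip B C)).trans (leg12 B T)).trans (leg23 A' (flip C' B))

/-- The unitary `Y X Y⁻¹`. -/
def conjBy (Y : A ≃ₗᵢ[ℂ] B) (X : A ≃ₗᵢ[ℂ] A) : B ≃ₗᵢ[ℂ] B :=
  (Y.symm.trans X).trans Y

/-- A unitary viewed as a bounded operator. -/
abbrev toOp (X : A ≃ₗᵢ[ℂ] B) : A →L[ℂ] B := (X.toContinuousLinearEquiv : A →L[ℂ] B)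

end

end HTensor

open HTensor

/-- The underlying data of a W*-category of Hilbert spaces with extra structure that carries a
tensor product. An object is a Hilbert space `K` with a structure `s : Str K` such that `IsObj s`;
the forgetful functor sends it to `K`. Since arrows are bounded operators and the tensor product of
two structures lives on the Hilbert space tensor product, the forgetful functor is faithful and
strictly monoidal by construction. `triv K` is the trivial structure `τ K`, and `τ` is the
identity on arrows. -/
structure TensorData where
  Str : ∀ (K : Type u) [NormedAddCommGroup K] [InnerProductSpace ℂ K] [CompleteSpace K], Type u
  IsObj : ∀ {K : Type u} [NormedAddCommGroup K] [InnerProductSpace ℂ K] [CompleteSpace K],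
    Str K → Prop
  Hom : ∀ {K₁ K₂ : Type u}
    [NormedAddCommGroup K₁] [InnerProductSpace ℂ K₁] [CompleteSpace K₁]
    [NormedAddCommGroup K₂] [InnerProductSpace ℂ K₂] [CompleteSpace K₂],
    Str K₁ → Str K₂ → Set (K₁ →L[ℂ] K₂)
  triv : ∀ (K : Type u) [NormedAddCommGroup K] [InnerProductSpace ℂ K] [CompleteSpace K], Str K
  tensor : ∀ {K₁ K₂ : Type u}
    [NormedAddCommGroup K₁] [InnerProductSpace ℂ K₁] [CompleteSpace K₁]
    [NormedAddCommGroup K₂] [InnerProductSpace ℂ K₂] [CompleteSpace K₂],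
    Str K₁ → Str K₂ → Str (HTensor K₁ K₂)

namespace TensorData

/-- The one-dimensional Hilbert space, the tensor unit. -/
abbrev UnitSpace : Type u := EuclideanSpace ℂ PUnit.{u + 1}

/-- The unit vector `1` of the tensor unit. -/
noncomputable abbrev unitVec : UnitSpace.{u} := EuclideanSpace.single PUnit.unit 1

/-- The unit transformation `K → ℂ ⊗ K`, `ξ ↦ 1 ⊗ ξ`. -/
noncomputable def leftUnit (K : Type u) [NormedAddCommGroup K] [InnerProductSpace ℂ K] :
    K →L[ℂ] HTensor UnitSpace.{u} K :=
  (incl UnitSpace.{u} K).toContinuousLinearMap ∘L TensorProduct.mkL ℂ UnitSpace.{u} K unitVec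

/-- The unit transformation `K → K ⊗ ℂ`, `ξ ↦ ξ ⊗ 1`. -/
noncomputable def rightUnit (K : Type u) [NormedAddCommGroup K] [InnerProductSpace ℂ K] :
    K →L[ℂ] HTensor K UnitSpace.{u} :=
  (incl K UnitSpace.{u}).toContinuousLinearMap ∘L
    (TensorProduct.mkL ℂ K UnitSpace.{u}).flip unitVec

/-- The axioms of a Hilbert space tensor category: a W*-category of Hilbert spaces with extra
structure (arrow spaces are weakly closed linear spaces of operators, closed under composition and
adjoints), monoidal with the associators and unit transformations of Hilbert spaces, with the
strict monoidal functor `τ`, such that structures are determined by their arrows and arrows may be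
cancelled from tensor products with (nonzero) objects. -/
structure IsHilbertSpaceTensorCategory (D : TensorData.{u}) : Prop where
  id_mem : ∀ {K : Type u} [NormedAddCommGroup K] [InnerProductSpace ℂ K] [CompleteSpace K]
    {s : D.Str K}, D.IsObj s → ContinuousLinearMap.id ℂ K ∈ D.Hom s s
  comp_mem : ∀ {K₁ K₂ K₃ : Type u}
    [NormedAddCommGroup K₁] [InnerProductSpace ℂ K₁] [CompleteSpace K₁]
    [NormedAddCommGroup K₂] [InnerProductSpace ℂ K₂] [CompleteSpace K₂]
    [NormedAddCommGroup K₃] [InnerProductSpace ℂ K₃] [CompleteSpace K₃]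
    {s₁ : D.Str K₁} {s₂ : D.Str K₂} {s₃ : D.Str K₃},
    D.IsObj s₁ → D.IsObj s₂ → D.IsObj s₃ →
    ∀ {a : K₁ →L[ℂ] K₂} {b : K₂ →L[ℂ] K₃}, a ∈ D.Hom s₁ s₂ → b ∈ D.Hom s₂ s₃ →
      b ∘L a ∈ D.Hom s₁ s₃
  zero_mem : ∀ {K₁ K₂ : Type u}
    [NormedAddCommGroup K₁] [InnerProductSpace ℂ K₁] [CompleteSpace K₁]
    [NormedAddCommGroup K₂] [InnerProductSpace ℂ K₂] [CompleteSpace K₂]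
    {s₁ : D.Str K₁} {s₂ : D.Str K₂}, D.IsObj s₁ → D.IsObj s₂ → 0 ∈ D.Hom s₁ s₂
  add_mem : ∀ {K₁ K₂ : Type u}
    [NormedAddCommGroup K₁] [InnerProductSpace ℂ K₁] [CompleteSpace K₁]
    [NormedAddCommGroup K₂] [InnerProductSpace ℂ K₂] [CompleteSpace K₂]
    {s₁ : D.Str K₁} {s₂ : D.Str K₂}, D.IsObj s₁ → D.IsObj s₂ →
    ∀ {a b : K₁ →L[ℂ] K₂}, a ∈ D.Hom s₁ s₂ → b ∈ D.Hom s₁ s₂ → a + b ∈ D.Hom s₁ s₂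
  smul_mem : ∀ {K₁ K₂ : Type u}
    [NormedAddCommGroup K₁] [InnerProductSpace ℂ K₁] [CompleteSpace K₁]
    [NormedAddCommGroup K₂] [InnerProductSpace ℂ K₂] [CompleteSpace K₂]
    {s₁ : D.Str K₁} {s₂ : D.Str K₂}, D.IsObj s₁ → D.IsObj s₂ →
    ∀ (c : ℂ) {a : K₁ →L[ℂ] K₂}, a ∈ D.Hom s₁ s₂ → c • a ∈ D.Hom s₁ s₂
  adjoint_mem : ∀ {K₁ K₂ : Type u}
    [NormedAddCommGroup K₁] [InnerProductSpace ℂ K₁] [CompleteSpace K₁]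
    [NormedAddCommGroup K₂] [InnerProductSpace ℂ K₂] [CompleteSpace K₂]
    {s₁ : D.Str K₁} {s₂ : D.Str K₂}, D.IsObj s₁ → D.IsObj s₂ →
    ∀ {a : K₁ →L[ℂ] K₂}, a ∈ D.Hom s₁ s₂ → ContinuousLinearMap.adjoint a ∈ D.Hom s₂ s₁
  weakly_closed : ∀ {K₁ K₂ : Type u}
    [NormedAddCommGroup K₁] [InnerProductSpace ℂ K₁] [CompleteSpace K₁]
    [NormedAddCommGroup K₂] [InnerProductSpace ℂ K₂] [CompleteSpace K₂]
    {s₁ : D.Str K₁} {s₂ : D.Str K₂}, D.IsObj s₁ → D.IsObj s₂ →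
    IsClosed {a : K₁ →WOT[ℂ] K₂ | a.toCLM ∈ D.Hom s₁ s₂}
  eq_of_id_mem : ∀ {K : Type u} [NormedAddCommGroup K] [InnerProductSpace ℂ K] [CompleteSpace K]
    {s s' : D.Str K}, D.IsObj s → D.IsObj s' → ContinuousLinearMap.id ℂ K ∈ D.Hom s s' → s = s'
  isObj_triv : ∀ (K : Type u) [NormedAddCommGroup K] [InnerProductSpace ℂ K] [CompleteSpace K],
    D.IsObj (D.triv K)
  hom_triv : ∀ {K₁ K₂ : Type u}
    [NormedAddCommGroup K₁] [InnerProductSpace ℂ K₁] [CompleteSpace K₁]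
    [NormedAddCommGroup K₂] [InnerProductSpace ℂ K₂] [CompleteSpace K₂]
    (a : K₁ →L[ℂ] K₂), a ∈ D.Hom (D.triv K₁) (D.triv K₂)
  isObj_tensor : ∀ {K₁ K₂ : Type u}
    [NormedAddCommGroup K₁] [InnerProductSpace ℂ K₁] [CompleteSpace K₁]
    [NormedAddCommGroup K₂] [InnerProductSpace ℂ K₂] [CompleteSpace K₂]
    {s₁ : D.Str K₁} {s₂ : D.Str K₂}, D.IsObj s₁ → D.IsObj s₂ → D.IsObj (D.tensor s₁ s₂)
  map_mem : ∀ {K₁ K₂ K₁' K₂' : Type u}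
    [NormedAddCommGroup K₁] [InnerProductSpace ℂ K₁] [CompleteSpace K₁]
    [NormedAddCommGroup K₂] [InnerProductSpace ℂ K₂] [CompleteSpace K₂]
    [NormedAddCommGroup K₁'] [InnerProductSpace ℂ K₁'] [CompleteSpace K₁']
    [NormedAddCommGroup K₂'] [InnerProductSpace ℂ K₂'] [CompleteSpace K₂']
    {s₁ : D.Str K₁} {s₂ : D.Str K₂} {s₁' : D.Str K₁'} {s₂' : D.Str K₂'},
    D.IsObj s₁ → D.IsObj s₂ → D.IsObj s₁' → D.IsObj s₂' →
    ∀ {a : K₁ →L[ℂ] K₁'} {b : K₂ →L[ℂ] K₂'}, a ∈ D.Hom s₁ s₁' → b ∈ D.Hom s₂ s₂' →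
      HTensor.map a b ∈ D.Hom (D.tensor s₁ s₂) (D.tensor s₁' s₂')
  tensor_triv : ∀ (K₁ K₂ : Type u)
    [NormedAddCommGroup K₁] [InnerProductSpace ℂ K₁] [CompleteSpace K₁]
    [NormedAddCommGroup K₂] [InnerProductSpace ℂ K₂] [CompleteSpace K₂],
    D.tensor (D.triv K₁) (D.triv K₂) = D.triv (HTensor K₁ K₂)
  assoc_mem : ∀ {K₁ K₂ K₃ : Type u}
    [NormedAddCommGroup K₁] [InnerProductSpace ℂ K₁] [CompleteSpace K₁]
    [NormedAddCommGroup K₂] [InnerProductSpace ℂ K₂] [CompleteSpace K₂]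
    [NormedAddCommGroup K₃] [InnerProductSpace ℂ K₃] [CompleteSpace K₃]
    {s₁ : D.Str K₁} {s₂ : D.Str K₂} {s₃ : D.Str K₃},
    D.IsObj s₁ → D.IsObj s₂ → D.IsObj s₃ →
    toOp (HTensor.assoc K₁ K₂ K₃) ∈
      D.Hom (D.tensor (D.tensor s₁ s₂) s₃) (D.tensor s₁ (D.tensor s₂ s₃))
  leftUnit_mem : ∀ {K : Type u} [NormedAddCommGroup K] [InnerProductSpace ℂ K] [CompleteSpace K]
    {s : D.Str K}, D.IsObj s → leftUnit K ∈ D.Hom s (D.tensor (D.triv UnitSpace.{u}) s)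
  rightUnit_mem : ∀ {K : Type u} [NormedAddCommGroup K] [InnerProductSpace ℂ K] [CompleteSpace K]
    {s : D.Str K}, D.IsObj s → rightUnit K ∈ D.Hom s (D.tensor s (D.triv UnitSpace.{u}))
  cancel_right : ∀ {K₁ K₂ Y : Type u}
    [NormedAddCommGroup K₁] [InnerProductSpace ℂ K₁] [CompleteSpace K₁]
    [NormedAddCommGroup K₂] [InnerProductSpace ℂ K₂] [CompleteSpace K₂]
    [NormedAddCommGroup Y] [InnerProductSpace ℂ Y] [CompleteSpace Y] [Nontrivial Y]
    {s₁ : D.Str K₁} {s₂ : D.Str K₂} {y : D.Str Y},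
    D.IsObj s₁ → D.IsObj s₂ → D.IsObj y → ∀ {a : K₁ →L[ℂ] K₂},
    HTensor.map a (ContinuousLinearMap.id ℂ Y) ∈ D.Hom (D.tensor s₁ y) (D.tensor s₂ y) →
      a ∈ D.Hom s₁ s₂
  cancel_left : ∀ {K₁ K₂ Y : Type u}
    [NormedAddCommGroup K₁] [InnerProductSpace ℂ K₁] [CompleteSpace K₁]
    [NormedAddCommGroup K₂] [InnerProductSpace ℂ K₂] [CompleteSpace K₂]
    [NormedAddCommGroup Y] [InnerProductSpace ℂ Y] [CompleteSpace Y] [Nontrivial Y]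
    {s₁ : D.Str K₁} {s₂ : D.Str K₂} {y : D.Str Y},
    D.IsObj s₁ → D.IsObj s₂ → D.IsObj y → ∀ {a : K₁ →L[ℂ] K₂},
    HTensor.map (ContinuousLinearMap.id ℂ Y) a ∈ D.Hom (D.tensor y s₁) (D.tensor y s₂) →
      a ∈ D.Hom s₁ s₂

/-- A natural right absorber (a regular object in the sense of Pinzari and Roberts): an object `ρ`
with unitary arrows `A x : x ⊗ ρ → τ x ⊗ ρ` that are natural in `x` and satisfy
`A (x₁ ⊗ x₂) = (A x₁)₁₃ (A x₂)₂₃`. -/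
structure IsNaturalRightAbsorber (D : TensorData.{u}) {R : Type u}
    [NormedAddCommGroup R] [InnerProductSpace ℂ R] [CompleteSpace R] (ρ : D.Str R)
    (A : ∀ {K : Type u} [NormedAddCommGroup K] [InnerProductSpace ℂ K] [CompleteSpace K],
      D.Str K → (HTensor K R ≃ₗᵢ[ℂ] HTensor K R)) : Prop where
  isObj : D.IsObj ρ
  mem_hom : ∀ {K : Type u} [NormedAddCommGroup K] [InnerProductSpace ℂ K] [CompleteSpace K]
    {x : D.Str K}, D.IsObj x → toOp (A x) ∈ D.Hom (D.tensor x ρ) (D.tensor (D.triv K) ρ)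
  natural : ∀ {K₁ K₂ : Type u}
    [NormedAddCommGroup K₁] [InnerProductSpace ℂ K₁] [CompleteSpace K₁]
    [NormedAddCommGroup K₂] [InnerProductSpace ℂ K₂] [CompleteSpace K₂]
    {x₁ : D.Str K₁} {x₂ : D.Str K₂}, D.IsObj x₁ → D.IsObj x₂ →
    ∀ {a : K₁ →L[ℂ] K₂}, a ∈ D.Hom x₁ x₂ →
      HTensor.map a (ContinuousLinearMap.id ℂ R) ∘L toOp (A x₁) =
        toOp (A x₂) ∘L HTensor.map a (ContinuousLinearMap.id ℂ R)
  tensor : ∀ {K₁ K₂ : Type u}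
    [NormedAddCommGroup K₁] [InnerProductSpace ℂ K₁] [CompleteSpace K₁]
    [NormedAddCommGroup K₂] [InnerProductSpace ℂ K₂] [CompleteSpace K₂]
    {x₁ : D.Str K₁} {x₂ : D.Str K₂}, D.IsObj x₁ → D.IsObj x₂ →
      A (D.tensor x₁ x₂) = leg13 K₂ (A x₁) * leg23 K₁ (A x₂)

end TensorData

section Braiding

variable {H L K : Type*}
  [NormedAddCommGroup H] [InnerProductSpace ℂ H]
  [NormedAddCommGroup L] [InnerProductSpace ℂ L]
  [NormedAddCommGroup K] [InnerProductSpace ℂ K]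

/-- The pentagon equation `W₂₃ W₁₂ = W₁₂ W₁₃ W₂₃`. -/
def IsMultiplicativeUnitary (W : HTensor H H ≃ₗᵢ[ℂ] HTensor H H) : Prop :=
  leg23 H W * leg12 H W = leg12 H W * leg13 H W * leg23 H W

/-- Right representations of `W`: `W₂₃ S₁₂ = S₁₂ S₁₃ W₂₃` on `K ⊗ H ⊗ H`. -/
def IsRightRep (W : HTensor H H ≃ₗᵢ[ℂ] HTensor H H) (S : HTensor K H ≃ₗᵢ[ℂ] HTensor K H) : Prop :=
  leg23 K W * leg12 H S = leg12 H S * leg13 H S * leg23 K W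

/-- Left representations of `W`: `V₂₃ W₁₂ = W₁₂ V₁₃ V₂₃` on `H ⊗ H ⊗ L`. -/
def IsLeftRep (W : HTensor H H ≃ₗᵢ[ℂ] HTensor H H) (V : HTensor H L ≃ₗᵢ[ℂ] HTensor H L) : Prop :=
  leg23 H V * leg12 L W = leg12 L W * leg13 H V * leg23 H V

/-- The equation `Z₁₃ = V₂₃ (S₁₂)* (V₂₃)* S₁₂` on `K ⊗ H ⊗ L`; it determines `Z` if `H ≠ 0`. -/
def IsBraidingUnitary (V : HTensor H L ≃ₗᵢ[ℂ] HTensor H L) (S : HTensor K H ≃ₗᵢ[ℂ] HTensor K H)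
    (Z : HTensor K L ≃ₗᵢ[ℂ] HTensor K L) : Prop :=
  leg13 H Z = leg23 K V * (leg12 L S)⁻¹ * (leg23 K V)⁻¹ * leg12 L S

/-- The braiding operator between `L` and `K` is defined. -/
def HasBraiding (V : HTensor H L ≃ₗᵢ[ℂ] HTensor H L) (S : HTensor K H ≃ₗᵢ[ℂ] HTensor K H) : Prop :=
  ∃ Z, IsBraidingUnitary V S Z

open Classical in
/-- The unitary `Z` with `Z₁₃ = V₂₃ (S₁₂)* (V₂₃)* S₁₂` (only used where it exists). -/
noncomputable def braidingUnitary (V : HTensor H L ≃ₗᵢ[ℂ] HTensor H L)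
    (S : HTensor K H ≃ₗᵢ[ℂ] HTensor K H) : HTensor K L ≃ₗᵢ[ℂ] HTensor K L :=
  if h : HasBraiding V S then h.choose else 1

/-- The braiding operator `Z Σ : L ⊗ K → K ⊗ L`. Its inverse is the dual braiding operator. -/
noncomputable def braiding (V : HTensor H L ≃ₗᵢ[ℂ] HTensor H L)
    (S : HTensor K H ≃ₗᵢ[ℂ] HTensor K H) : HTensor L K ≃ₗᵢ[ℂ] HTensor K L :=
  (HTensor.flip L K).trans (braidingUnitary V S)

end Braiding

/-- A (top-)braided multiplicative unitary `(W, U, V, F)`: `W` is a multiplicative unitary on `H`,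
`L` carries a right representation `U` and a left representation `V` of `W` that satisfy the
Yetter–Drinfeld compatibility condition, and `F` is equivariant for `U` and `V` and satisfies the
braided pentagon equation; the braiding operator on `L ⊗ L` is part of that equation. -/
structure BraidedMultiplicativeUnitary (H L : Type u)
    [NormedAddCommGroup H] [InnerProductSpace ℂ H]
    [NormedAddCommGroup L] [InnerProductSpace ℂ L] where
  W : HTensor H H ≃ₗᵢ[ℂ] HTensor H H
  U : HTensor L H ≃ₗᵢ[ℂ] HTensor L H
  V : HTensor H L ≃ₗᵢ[ℂ] HTensor H L
  F : HTensor L L ≃ₗᵢ[ℂ] HTensor L L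
  pentagon : IsMultiplicativeUnitary W
  rightRep : IsRightRep W U
  leftRep : IsLeftRep W V
  /-- `V₁₂ W₁₃ U₂₃ = U₂₃ W₁₃ V₁₂` on `H ⊗ L ⊗ H`. -/
  yetterDrinfeld : leg12 H V * leg13 L W * leg23 H U = leg23 H U * leg13 L W * leg12 H V
  /-- `U₁₃ U₂₃ F₁₂ = F₁₂ U₁₃ U₂₃` on `L ⊗ L ⊗ H`. -/
  equivariant_right : leg13 L U * leg23 L U * leg12 H F = leg12 H F * (leg13 L U * leg23 L U)
  /-- `V₁₃ V₁₂ F₂₃ = F₂₃ V₁₃ V₁₂` on `H ⊗ L ⊗ L`. -/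
  equivariant_left : leg13 L V * leg12 L V * leg23 H F = leg23 H F * (leg13 L V * leg12 L V)
  hasBraiding : HasBraiding V U
  /-- The top-braided pentagon equation on `L ⊗ L ⊗ L`. -/
  braidedPentagon : leg23 L F * leg12 L F =
    leg12 L F * conjBy (leg23 L (braiding V U)) (leg12 L F) * leg23 L F

namespace BraidedMultiplicativeUnitary

noncomputable section

variable {H L : Type u}
  [NormedAddCommGroup H] [InnerProductSpace ℂ H]
  [NormedAddCommGroup L] [InnerProductSpace ℂ L]
  (B : BraidedMultiplicativeUnitary H L)

/-- A pair of unitaries `S` on `K ⊗ H` and `T` on `K ⊗ L`. -/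
@[ext]
structure PreRep (_B : BraidedMultiplicativeUnitary H L)
    (K : Type u) [NormedAddCommGroup K] [InnerProductSpace ℂ K] where
  S : HTensor K H ≃ₗᵢ[ℂ] HTensor K H
  T : HTensor K L ≃ₗᵢ[ℂ] HTensor K L

variable {K K₁ K₂ : Type u}
  [NormedAddCommGroup K] [InnerProductSpace ℂ K]
  [NormedAddCommGroup K₁] [InnerProductSpace ℂ K₁]
  [NormedAddCommGroup K₂] [InnerProductSpace ℂ K₂]

/-- Right representations `(K, S, T)` of `(W, U, V, F)`. The tensor product of representations
uses the braiding operators between `L` and `K`, so these are required to be defined. -/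
structure IsRep (x : B.PreRep K) : Prop where
  rightRep : IsRightRep B.W x.S
  hasBraiding : HasBraiding B.V x.S
  /-- `S₁₃ U₂₃ T₁₂ = T₁₂ S₁₃ U₂₃` on `K ⊗ L ⊗ H`. -/
  equivariant : leg13 L x.S * leg23 K B.U * leg12 H x.T =
    leg12 H x.T * (leg13 L x.S * leg23 K B.U)
  /-- The top-braided representation condition on `K ⊗ L ⊗ L`. -/
  braidedRep : leg23 K B.F * leg12 L x.T =
    leg12 L x.T * conjBy (leg23 K (braiding B.V B.U)) (leg12 L x.T) * leg23 K B.F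

/-- Intertwiners: `(a ⊗ 1) S₁ = S₂ (a ⊗ 1)` and `(a ⊗ 1) T₁ = T₂ (a ⊗ 1)`. -/
def Intertwiner (x₁ : B.PreRep K₁) (x₂ : B.PreRep K₂) : Set (K₁ →L[ℂ] K₂) :=
  {a | HTensor.map a (ContinuousLinearMap.id ℂ H) ∘L toOp x₁.S =
      toOp x₂.S ∘L HTensor.map a (ContinuousLinearMap.id ℂ H) ∧
    HTensor.map a (ContinuousLinearMap.id ℂ L) ∘L toOp x₁.T =
      toOp x₂.T ∘L HTensor.map a (ContinuousLinearMap.id ℂ L)}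

/-- The tensor product, with
`S = (S₁)₁₃ (S₂)₂₃` and `T = (braiding)₂₃ (T₁)₁₂ (dual braiding)₂₃ (T₂)₂₃`. -/
def tensorRep (x₁ : B.PreRep K₁) (x₂ : B.PreRep K₂) : B.PreRep (HTensor K₁ K₂) where
  S := leg13 K₂ x₁.S * leg23 K₁ x₂.S
  T := conjBy (leg23 K₁ (braiding B.V x₂.S)) (leg12 K₂ x₁.T) * leg23 K₁ x₂.T

/-- The tensor category of representations of `(W, U, V, F)`. -/
def corep : TensorData.{u} where
  Str K _ _ _ := B.PreRep K
  IsObj x := B.IsRep x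
  Hom x₁ x₂ := B.Intertwiner x₁ x₂
  triv _ _ _ _ := ⟨1, 1⟩
  tensor x₁ x₂ := B.tensorRep x₁ x₂

/-- The triple `(H, W, 1)`. -/
def regularRep : B.PreRep H := ⟨B.W, 1⟩

/-- The triple `(L, U, F)`. -/
def braidedRegularRep : B.PreRep L := ⟨B.U, B.F⟩

/-- `ρ = (H, W, 1) ⊗ (L, U, F)`, with underlying Hilbert space `H ⊗ L`. -/
def absorber : B.PreRep (HTensor H L) := B.tensorRep B.regularRep B.braidedRegularRep

/-- The absorbing intertwiner of `x = (K, S, T)` on `K ⊗ H ⊗ L`: the second unitary of the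
representation `x ⊗ (H, W, 1)` followed by `S₁₂`. -/
def absorbing (x : B.PreRep K) : HTensor K (HTensor H L) ≃ₗᵢ[ℂ] HTensor K (HTensor H L) :=
  conjBy (HTensor.assoc K H L) (leg12 L x.S * (B.tensorRep x B.regularRep).T)

end

end BraidedMultiplicativeUnitary

/-!
The equations for a multiplicative unitary, for its right and left representations and for the
braiding all have the shape `V₂₃ S₁₂ = S₁₂ X₁₃ V₂₃`. This relation is multiplicative in the pair
`(S, X)` and, since `H ≠ 0`, it determines `X` from `S` and `V`, naturally with respect to
intertwiners of `S`. Hence the braiding is natural and multiplicative in the representation.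

A triple `(K, S, T)` is a representation exactly when `T` is an arrow
`(K, S, T) ⊗ (L, U, F) → (K, S, 1) ⊗ (L, U, F)`, and the braiding of `(K, S, 1)` with `(L, U, F)` is
an arrow as well. So `T₁ ⊤ T₂` is a composition of arrows, which gives tensor products of
representations, and applying this to `(K, S, T) ⊗ (H, W, 1)` shows that the absorbing unitary is
an arrow: the remaining factor `S` is an arrow `(K ⊗ H, S₁₃ W₂₃, 1) → (K ⊗ H, W₂₃, 1)` by the
equation for right representations.
-/

namespace HTensor

noncomputable section

variable {A B C D A' B' C' M N M' N' X X' : Type*}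
  [NormedAddCommGroup A] [InnerProductSpace ℂ A]
  [NormedAddCommGroup B] [InnerProductSpace ℂ B]
  [NormedAddCommGroup C] [InnerProductSpace ℂ C]
  [NormedAddCommGroup D] [InnerProductSpace ℂ D]
  [NormedAddCommGroup A'] [InnerProductSpace ℂ A']
  [NormedAddCommGroup B'] [InnerProductSpace ℂ B']
  [NormedAddCommGroup C'] [InnerProductSpace ℂ C']
  [NormedAddCommGroup M] [InnerProductSpace ℂ M]
  [NormedAddCommGroup N] [InnerProductSpace ℂ N]
  [NormedAddCommGroup M'] [InnerProductSpace ℂ M']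
  [NormedAddCommGroup N'] [InnerProductSpace ℂ N']
  [NormedAddCommGroup X] [InnerProductSpace ℂ X]
  [NormedAddCommGroup X'] [InnerProductSpace ℂ X']

variable (A B) in
/-- The bounded bilinear map `(x, y) ↦ x ⊗ y`. -/
def mkL : A →L[ℂ] B →L[ℂ] HTensor A B :=
  ContinuousLinearMap.compL ℂ B (A ⊗[ℂ] B) (HTensor A B) (incl A B).toContinuousLinearMap ∘L
    TensorProduct.mkL ℂ A B

@[simp]
theorem mkL_apply (x : A) (y : B) : mkL A B x y = tmul x y := rfl

theorem add_tmul (x x' : A) (y : B) : tmul (x + x') y = tmul x y + tmul x' y :=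
  congrArg (· y) ((mkL A B).map_add x x')

theorem smul_tmul (c : ℂ) (x : A) (y : B) : tmul (c • x) y = c • tmul x y :=
  congrArg (· y) ((mkL A B).map_smul c x)

attribute [simp] map_tmul congr_tmul flip_tmul assoc_tmul

theorem inner_tmul (x x' : A) (y y' : B) :
    inner ℂ (tmul x y) (tmul x' y') = inner ℂ x x' * inner ℂ y y' := by
  rw [tmul, tmul, LinearIsometry.inner_map_map, TensorProduct.inner_tmul]

theorem tmul_left_injective {y : B} (hy : y ≠ 0) :
    Function.Injective fun x : A => tmul x y :=
  (injective_iff_map_eq_zero ((mkL A B).flip y)).mpr fun x hx => by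
    have h : ‖tmul x y‖ = 0 := norm_eq_zero.mpr hx
    rw [tmul, LinearIsometry.norm_map, TensorProduct.norm_tmul] at h
    simpa [hy] using h

/-- Stated with bilinear maps so that `ext` descends into nested tensor products. -/
@[ext]
theorem clm_ext {Y : Type*} [NormedAddCommGroup Y] [NormedSpace ℂ Y] {f g : HTensor A B →L[ℂ] Y}
    (h : ContinuousLinearMap.compL ℂ B (HTensor A B) Y f ∘L mkL A B =
      ContinuousLinearMap.compL ℂ B (HTensor A B) Y g ∘L mkL A B) : f = g := by
  refine ContinuousLinearMap.coeFn_injective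
    (denseRange_incl.equalizer f.continuous g.continuous (funext fun z => ?_))
  induction z with
  | zero => simp
  | add z w hz hw => simpa using congrArg₂ (· + ·) hz hw
  | tmul x y => exact congrArg (fun k => k x y) h

theorem toOp_injective : Function.Injective (toOp : (X ≃ₗᵢ[ℂ] X') → X →L[ℂ] X') := fun _ _ h =>
  LinearIsometryEquiv.ext fun x => congrArg (fun k => k x) h

@[simp]
theorem assoc_symm_tmul (x : A) (y : B) (z : C) :
    (assoc A B C).symm (tmul x (tmul y z)) = tmul (tmul x y) z := by
  rw [← assoc_tmul, LinearIsometryEquiv.symm_apply_apply]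

@[simp]
theorem flip_symm : (flip A B).symm = flip B A :=
  toOp_injective <| by
    ext x y
    exact (LinearIsometryEquiv.symm_apply_eq _).mpr (by simp)

theorem toOp_congr (S : A ≃ₗᵢ[ℂ] A') (T : B ≃ₗᵢ[ℂ] B') :
    toOp (congr S T) = map (toOp S) (toOp T) := by
  ext; simp

@[simp]
theorem map_id_id : map (.id ℂ A) (.id ℂ B) = .id ℂ (HTensor A B) := by
  ext; simp

theorem map_comp_map {A'' B'' : Type*}
    [NormedAddCommGroup A''] [InnerProductSpace ℂ A'']
    [NormedAddCommGroup B''] [InnerProductSpace ℂ B'']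
    (a' : A' →L[ℂ] A'') (b' : B' →L[ℂ] B'') (a : A →L[ℂ] A') (b : B →L[ℂ] B') :
    map a' b' ∘L map a b = map (a' ∘L a) (b' ∘L b) := by
  ext; simp

theorem zero_map (b : B →L[ℂ] B') : map (0 : A →L[ℂ] A') b = 0 := by
  ext x y
  exact (map_tmul 0 b x y).trans (congrArg (· (b y)) (mkL A' B').map_zero)

theorem add_map (a a' : A →L[ℂ] A') (b : B →L[ℂ] B') : map (a + a') b = map a b + map a' b := by
  ext; simp [add_tmul]

theorem smul_map (c : ℂ) (a : A →L[ℂ] A') (b : B →L[ℂ] B') : map (c • a) b = c • map a b := by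
  ext; simp [smul_tmul]

theorem conjBy_mul (Y : X ≃ₗᵢ[ℂ] X') (S T : X ≃ₗᵢ[ℂ] X) :
    conjBy Y (S * T) = conjBy Y S * conjBy Y T :=
  LinearIsometryEquiv.ext fun x => by simp [conjBy]

theorem conjBy_one (Y : X ≃ₗᵢ[ℂ] X') : conjBy Y 1 = 1 :=
  LinearIsometryEquiv.ext fun x => by simp [conjBy]

/-- The bounded operator `f` intertwines the unitaries `S` and `T`: `f S = T f`. -/
def Intertwines (f : X →L[ℂ] X') (S : X ≃ₗᵢ[ℂ] X) (T : X' ≃ₗᵢ[ℂ] X') : Prop :=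
  f ∘L toOp S = toOp T ∘L f

namespace Intertwines

variable {f : X →L[ℂ] X'} {S S' : X ≃ₗᵢ[ℂ] X} {T T' : X' ≃ₗᵢ[ℂ] X'}

protected theorem apply (h : Intertwines f S T) (x : X) : f (S x) = T (f x) :=
  congrArg (fun k => k x) h

protected theorem one (f : X →L[ℂ] X') : Intertwines f 1 1 := rfl

protected theorem id (S : X ≃ₗᵢ[ℂ] X) : Intertwines (.id ℂ X) S S := rfl

protected theorem mul (h : Intertwines f S T) (h' : Intertwines f S' T') :
    Intertwines f (S * S') (T * T') :=
  ContinuousLinearMap.ext fun x => (h.apply (S' x)).trans (congrArg T (h'.apply x))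

protected theorem inv (h : Intertwines f S T) : Intertwines f S⁻¹ T⁻¹ :=
  ContinuousLinearMap.ext fun x => T.injective <| by
    change T (f (S.symm x)) = T (T.symm (f x))
    rw [← h.apply, S.apply_symm_apply, T.apply_symm_apply]

protected theorem comp {Y : Type*} [NormedAddCommGroup Y] [InnerProductSpace ℂ Y]
    {g : X' →L[ℂ] Y} {R : Y ≃ₗᵢ[ℂ] Y} (hg : Intertwines g T R) (hf : Intertwines f S T) :
    Intertwines (g ∘L f) S R :=
  ContinuousLinearMap.ext fun x => (congrArg g (hf.apply x)).trans (hg.apply (f x))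

protected theorem zero (S : X ≃ₗᵢ[ℂ] X) (T : X' ≃ₗᵢ[ℂ] X') : Intertwines 0 S T :=
  ContinuousLinearMap.ext fun _ => (map_zero T).symm

protected theorem add {g : X →L[ℂ] X'} (hf : Intertwines f S T) (hg : Intertwines g S T) :
    Intertwines (f + g) S T :=
  ContinuousLinearMap.ext fun x =>
    (congrArg₂ (· + ·) (hf.apply x) (hg.apply x)).trans (map_add T _ _).symm

protected theorem smul (c : ℂ) (hf : Intertwines f S T) : Intertwines (c • f) S T :=
  ContinuousLinearMap.ext fun x => (congrArg (c • ·) (hf.apply x)).trans (map_smul T c _).symm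

theorem of_inverse {g : X' →L[ℂ] X} (h : Intertwines f S T) (hfg : f ∘L g = .id ℂ X')
    (hgf : g ∘L f = .id ℂ X) : Intertwines g T S :=
  ContinuousLinearMap.ext fun x => by
    have hfg' : f (g x) = x := congrArg (· x) hfg
    have hgf' : g (f (S (g x))) = S (g x) := congrArg (· (S (g x))) hgf
    change g (T x) = S (g x)
    rw [← hgf', h.apply, hfg']

protected theorem conjBy {Z Z' : Type*} [NormedAddCommGroup Z] [InnerProductSpace ℂ Z]
    [NormedAddCommGroup Z'] [InnerProductSpace ℂ Z'] {Y : X ≃ₗᵢ[ℂ] Z} {Y' : X' ≃ₗᵢ[ℂ] Z'}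
    {F : Z →L[ℂ] Z'} (h : Intertwines f S T) (hF : F ∘L toOp Y = toOp Y' ∘L f) :
    Intertwines F (conjBy Y S) (conjBy Y' T) :=
  ContinuousLinearMap.ext fun z => by
    have hF' (x : X) : F (Y x) = Y' (f x) := congrArg (· x) hF
    obtain ⟨x, rfl⟩ := Y.surjective z
    simp [HTensor.conjBy, hF', h.apply]

end Intertwines

theorem intertwines_toOp_iff {R S T : X ≃ₗᵢ[ℂ] X} :
    Intertwines (toOp R) S T ↔ SemiconjBy R S T :=
  toOp_injective.eq_iff (a := R * S) (b := T * R)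

theorem intertwines_conjBy (Y : X ≃ₗᵢ[ℂ] X') (S : X ≃ₗᵢ[ℂ] X) :
    Intertwines (toOp Y) S (conjBy Y S) := by
  ext; simp [conjBy]

/-- The amplification `T ↦ T ⊗ 1` to `M ⊗ N`, transported along a unitary `M ⊗ N ≃ X` that
permutes tensor factors. Every leg numbering is of this form. -/
def amplify (e : HTensor M N ≃ₗᵢ[ℂ] X) : (M ≃ₗᵢ[ℂ] M) →* (X ≃ₗᵢ[ℂ] X) where
  toFun T := conjBy e (congr T (.refl ℂ N))
  map_one' := by
    have h : congr 1 (.refl ℂ N) = (1 : HTensor M N ≃ₗᵢ[ℂ] HTensor M N) :=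
      toOp_injective <| by
        ext x y
        exact congr_tmul 1 (.refl ℂ N) x y
    rw [h, conjBy_one]
  map_mul' S T := by
    have h : congr (S * T) (.refl ℂ N) = congr S (.refl ℂ N) * congr T (.refl ℂ N) :=
      toOp_injective <| by
        ext x y
        change congr (S * T) _ (tmul x y) = congr S _ (congr T _ (tmul x y))
        simp only [congr_tmul]
        rfl
    rw [h, conjBy_mul]

@[simp]
theorem amplify_apply_tmul (e : HTensor M N ≃ₗᵢ[ℂ] X) (T : M ≃ₗᵢ[ℂ] M) (x : M) (y : N) :
    amplify e T (e (tmul x y)) = e (tmul (T x) y) := by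
  simp [amplify, conjBy]

theorem eq_amplify {e : HTensor M N ≃ₗᵢ[ℂ] X} {T : M ≃ₗᵢ[ℂ] M} {R : X ≃ₗᵢ[ℂ] X}
    (h : toOp R ∘L toOp e = toOp e ∘L map (toOp T) (.id ℂ N)) : R = amplify e T := by
  have hcomp : toOp R ∘L toOp e = toOp (amplify e T) ∘L toOp e := by
    rw [h]
    ext
    simp
  refine LinearIsometryEquiv.ext fun z => ?_
  simpa using congrArg (· (e.symm z)) hcomp

theorem Intertwines.amplify {e : HTensor M N ≃ₗᵢ[ℂ] X} {e' : HTensor M' N' ≃ₗᵢ[ℂ] X'}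
    {f : M →L[ℂ] M'} {S : M ≃ₗᵢ[ℂ] M} {T : M' ≃ₗᵢ[ℂ] M'} {F : X →L[ℂ] X'}
    (h : Intertwines f S T) (g : N →L[ℂ] N') (hF : F ∘L toOp e = toOp e' ∘L map f g) :
    Intertwines F (amplify e S) (amplify e' T) := by
  have hfg : Intertwines (map f g) (congr S (.refl ℂ N)) (congr T (.refl ℂ N')) := by
    ext x y
    simp [h.apply]
  exact hfg.conjBy hF

theorem amplify_eq_amplify {e : HTensor M N ≃ₗᵢ[ℂ] X} {e' : HTensor M' N' ≃ₗᵢ[ℂ] X}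
    {f : M →L[ℂ] M'} {S : M ≃ₗᵢ[ℂ] M} {T : M' ≃ₗᵢ[ℂ] M'}
    (h : Intertwines f S T) (g : N →L[ℂ] N') (he : toOp e = toOp e' ∘L map f g) :
    amplify e S = amplify e' T :=
  toOp_injective (h.amplify (F := .id ℂ X) g he)

theorem commute_amplify {e : HTensor M N ≃ₗᵢ[ℂ] X} {e' : HTensor N M ≃ₗᵢ[ℂ] X}
    (h : toOp e' = toOp e ∘L toOp (flip N M)) (S : M ≃ₗᵢ[ℂ] M) (T : N ≃ₗᵢ[ℂ] N) :
    Commute (amplify e S) (amplify e' T) := by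
  have h' (y : N) (x : M) : e' (tmul y x) = e (tmul x y) := by
    simpa using congrArg (· (tmul y x)) h
  refine intertwines_toOp_iff.mp ((Intertwines.id T).amplify (toOp S) ?_)
  ext
  simp [h']

theorem amplify_amplify (e' : HTensor X N' ≃ₗᵢ[ℂ] X') (e : HTensor M N ≃ₗᵢ[ℂ] X)
    (T : M ≃ₗᵢ[ℂ] M) :
    amplify e' (amplify e T) =
      amplify (((assoc M N N').symm.trans (congr e (.refl ℂ N'))).trans e') T := by
  refine eq_amplify ?_
  ext
  simp

theorem intertwines_amplify_tmul (e : HTensor M N ≃ₗᵢ[ℂ] X) (T : M ≃ₗᵢ[ℂ] M) (y : N) :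
    Intertwines (toOp e ∘L (mkL M N).flip y) T (amplify e T) := by
  ext
  simp

theorem Intertwines.of_amplify [Nontrivial N] {e : HTensor M N ≃ₗᵢ[ℂ] X}
    {e' : HTensor M' N ≃ₗᵢ[ℂ] X'} {f : M →L[ℂ] M'} {S : M ≃ₗᵢ[ℂ] M} {T : M' ≃ₗᵢ[ℂ] M'}
    {F : X →L[ℂ] X'} (hF : F ∘L toOp e = toOp e' ∘L map f (.id ℂ N))
    (h : Intertwines F (HTensor.amplify e S) (HTensor.amplify e' T)) : Intertwines f S T := by
  obtain ⟨y, hy⟩ := exists_ne (0 : N)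
  have hF' (x : M) : F (e (tmul x y)) = e' (tmul (f x) y) := by
    simpa using congrArg (· (tmul x y)) hF
  ext x
  refine tmul_left_injective hy (e'.injective ?_)
  simpa [hF'] using h.apply (e (tmul x y))

theorem amplify_injective [Nontrivial N] (e : HTensor M N ≃ₗᵢ[ℂ] X) :
    Function.Injective (amplify e) := fun S T h =>
  toOp_injective <| Intertwines.of_amplify (F := .id ℂ X) (f := .id ℂ M) (by simp)
    (congrArg toOp h)

variable (A B C) in
/-- The unitary `(x ⊗ y) ⊗ z ↦ (x ⊗ z) ⊗ y`. -/
def rightComm : HTensor (HTensor A B) C ≃ₗᵢ[ℂ] HTensor (HTensor A C) B :=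
  leg23 A (flip B C)

variable (A B C) in
/-- The unitary `(y ⊗ z) ⊗ x ↦ (x ⊗ y) ⊗ z`. -/
def rotate : HTensor (HTensor B C) A ≃ₗᵢ[ℂ] HTensor (HTensor A B) C :=
  (flip (HTensor B C) A).trans (assoc A B C).symm

@[simp]
theorem rightComm_tmul (x : A) (y : B) (z : C) :
    rightComm A B C (tmul (tmul x y) z) = tmul (tmul x z) y := by
  simp [rightComm, leg23]

@[simp]
theorem rotate_tmul (x : A) (y : B) (z : C) :
    rotate A B C (tmul (tmul y z) x) = tmul (tmul x y) z := by
  simp [rotate]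

@[simp]
theorem rightComm_symm : (rightComm A B C).symm = rightComm A C B :=
  toOp_injective <| by
    ext x y z
    exact (LinearIsometryEquiv.symm_apply_eq _).mpr (by simp)

theorem leg12_eq_amplify (T : HTensor A B ≃ₗᵢ[ℂ] HTensor A B) :
    leg12 C T = amplify (.refl ℂ _) T := rfl

theorem leg13_eq_amplify (T : HTensor A C ≃ₗᵢ[ℂ] HTensor A C) :
    leg13 B T = amplify (rightComm A C B) T := by
  rw [leg13, amplify, MonoidHom.coe_mk, OneHom.coe_mk, conjBy, rightComm_symm]
  rfl

theorem leg23_eq_amplify (T : HTensor B C ≃ₗᵢ[ℂ] HTensor B C) :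
    leg23 A T = amplify (rotate A B C) T := by
  have h : congr (.refl ℂ A) T = conjBy (flip (HTensor B C) A) (congr T (.refl ℂ A)) :=
    toOp_injective <| by
      ext x y z
      simp [conjBy]
  rw [leg23, h]
  rfl

section ThreeLegs

theorem leg12_mul (S T : HTensor A B ≃ₗᵢ[ℂ] HTensor A B) :
    leg12 C (S * T) = leg12 C S * leg12 C T :=
  map_mul (amplify (.refl ℂ _)) S T

theorem leg12_one : leg12 C (1 : HTensor A B ≃ₗᵢ[ℂ] HTensor A B) = 1 :=
  map_one (amplify (.refl ℂ _))

theorem leg12_inv (T : HTensor A B ≃ₗᵢ[ℂ] HTensor A B) : leg12 C T⁻¹ = (leg12 C T)⁻¹ :=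
  map_inv (amplify (.refl ℂ _)) T

theorem toOp_leg12 (T : HTensor A B ≃ₗᵢ[ℂ] HTensor A' B') :
    toOp (leg12 C T) = map (toOp T) (.id ℂ C) :=
  toOp_congr T (.refl ℂ C)

theorem leg13_mul (S T : HTensor A C ≃ₗᵢ[ℂ] HTensor A C) :
    leg13 B (S * T) = leg13 B S * leg13 B T := by
  simp only [leg13_eq_amplify, map_mul]

theorem leg13_one : leg13 B (1 : HTensor A C ≃ₗᵢ[ℂ] HTensor A C) = 1 := by
  rw [leg13_eq_amplify, map_one]

theorem leg13_inv (T : HTensor A C ≃ₗᵢ[ℂ] HTensor A C) : leg13 B T⁻¹ = (leg13 B T)⁻¹ := by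
  simp only [leg13_eq_amplify, map_inv]

theorem leg23_mul (S T : HTensor B C ≃ₗᵢ[ℂ] HTensor B C) :
    leg23 A (S * T) = leg23 A S * leg23 A T := by
  simp only [leg23_eq_amplify, map_mul]

theorem leg23_one : leg23 A (1 : HTensor B C ≃ₗᵢ[ℂ] HTensor B C) = 1 := by
  rw [leg23_eq_amplify, map_one]

theorem leg23_inv (T : HTensor B C ≃ₗᵢ[ℂ] HTensor B C) : leg23 A T⁻¹ = (leg23 A T)⁻¹ := by
  simp only [leg23_eq_amplify, map_inv]

theorem leg13_injective [Nontrivial B] {S T : HTensor A C ≃ₗᵢ[ℂ] HTensor A C}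
    (h : leg13 B S = leg13 B T) : S = T := by
  rw [leg13_eq_amplify, leg13_eq_amplify] at h
  exact amplify_injective _ h

namespace Intertwines

theorem leg12 {f : HTensor A B →L[ℂ] HTensor A' B'} {S : HTensor A B ≃ₗᵢ[ℂ] HTensor A B}
    {T : HTensor A' B' ≃ₗᵢ[ℂ] HTensor A' B'} (h : Intertwines f S T) (c : C →L[ℂ] C') :
    Intertwines (map f c) (leg12 C S) (leg12 C' T) := by
  simp only [leg12_eq_amplify]
  exact h.amplify c (by ext; simp)

variable {b : B →L[ℂ] B'} {c : C →L[ℂ] C'}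

theorem leg13 {a : A →L[ℂ] A'} {S : HTensor A C ≃ₗᵢ[ℂ] HTensor A C}
    {T : HTensor A' C' ≃ₗᵢ[ℂ] HTensor A' C'} (h : Intertwines (map a c) S T) (b : B →L[ℂ] B') :
    Intertwines (map (map a b) c) (leg13 B S) (leg13 B' T) := by
  simp only [leg13_eq_amplify]
  exact h.amplify b (by ext; simp)

theorem leg23 {S : HTensor B C ≃ₗᵢ[ℂ] HTensor B C} {T : HTensor B' C' ≃ₗᵢ[ℂ] HTensor B' C'}
    (h : Intertwines (map b c) S T) (a : A →L[ℂ] A') :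
    Intertwines (map (map a b) c) (leg23 A S) (leg23 A' T) := by
  simp only [leg23_eq_amplify]
  exact h.amplify a (by ext; simp)

theorem of_leg13 [Nontrivial B] {a : A →L[ℂ] A'} {S : HTensor A C ≃ₗᵢ[ℂ] HTensor A C}
    {T : HTensor A' C' ≃ₗᵢ[ℂ] HTensor A' C'}
    (h : Intertwines (map (map a (.id ℂ B)) c) (HTensor.leg13 B S) (HTensor.leg13 B T)) :
    Intertwines (map a c) S T := by
  simp only [leg13_eq_amplify] at h
  exact .of_amplify (by ext; simp) h

theorem of_leg23 [Nontrivial A] {S : HTensor B C ≃ₗᵢ[ℂ] HTensor B C}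
    {T : HTensor B' C' ≃ₗᵢ[ℂ] HTensor B' C'}
    (h : Intertwines (map (map (.id ℂ A) b) c) (HTensor.leg23 A S) (HTensor.leg23 A T)) :
    Intertwines (map b c) S T := by
  simp only [leg23_eq_amplify] at h
  exact .of_amplify (by ext; simp) h

end Intertwines

theorem intertwines_flip_leg13 (T : HTensor A C ≃ₗᵢ[ℂ] HTensor A C) :
    Intertwines (map (toOp (flip A B)) (.id ℂ C)) (leg13 B T) (leg23 B T) := by
  simp only [leg13_eq_amplify, leg23_eq_amplify]
  exact (Intertwines.id T).amplify (.id ℂ _) (by ext; simp)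

theorem intertwines_flip_leg23 (T : HTensor B C ≃ₗᵢ[ℂ] HTensor B C) :
    Intertwines (map (toOp (flip A B)) (.id ℂ C)) (leg23 A T) (leg13 A T) := by
  simp only [leg13_eq_amplify, leg23_eq_amplify]
  exact (Intertwines.id T).amplify (.id ℂ _) (by ext; simp)

theorem leg23_trans (X : HTensor B C ≃ₗᵢ[ℂ] HTensor B' C')
    (Y : HTensor B' C' ≃ₗᵢ[ℂ] HTensor M N) :
    leg23 A (X.trans Y) = (leg23 A X).trans (leg23 A Y) := by
  have h : congr (.refl ℂ A) (X.trans Y) = (congr (.refl ℂ A) X).trans (congr (.refl ℂ A) Y) :=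
    toOp_injective <| by
      ext x y z
      simp
  refine LinearIsometryEquiv.ext fun v => ?_
  simp [leg23, h]

theorem conjBy_leg23_flip_trans (Z : HTensor B C ≃ₗᵢ[ℂ] HTensor B C)
    (T : HTensor A C ≃ₗᵢ[ℂ] HTensor A C) :
    conjBy (leg23 A ((flip C B).trans Z)) (leg12 B T) =
      leg23 A Z * leg13 B T * (leg23 A Z)⁻¹ := by
  have h : (leg23 A (flip C B)).symm = leg23 A (flip B C) := rightComm_symm
  refine LinearIsometryEquiv.ext fun v => ?_
  rw [leg23_trans, leg13, ← h]
  rfl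

theorem intertwines_tmul_leg13 (T : HTensor A C ≃ₗᵢ[ℂ] HTensor A C) (y : B) :
    Intertwines (map ((mkL A B).flip y) (.id ℂ C)) T (leg13 B T) := by
  have h : map ((mkL A B).flip y) (.id ℂ C) =
      toOp (rightComm A C B) ∘L (mkL (HTensor A C) B).flip y := by
    ext; simp
  rw [h, leg13_eq_amplify]
  exact intertwines_amplify_tmul _ T y

theorem intertwines_tmul_leg23 (T : HTensor B C ≃ₗᵢ[ℂ] HTensor B C) (x : A) :
    Intertwines (map (mkL A B x) (.id ℂ C)) T (leg23 A T) := by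
  have h : map (mkL A B x) (.id ℂ C) =
      toOp (rotate A B C) ∘L (mkL (HTensor B C) A).flip x := by
    ext; simp
  rw [h, leg23_eq_amplify]
  exact intertwines_amplify_tmul _ T x

end ThreeLegs

section WeakClosedness

theorem ext_inner_tmul {v w : HTensor A B}
    (h : ∀ x y, inner ℂ (tmul x y) v = inner ℂ (tmul x y) w) : v = w := by
  have hvw : innerSL ℂ v = innerSL ℂ w := by
    ext x y
    simpa using congrArg (starRingEnd ℂ) (h x y)
  exact ext_inner_right ℂ fun z => congrArg (· z) hvw

theorem Intertwines.adjoint [CompleteSpace X] [CompleteSpace X'] {f : X →L[ℂ] X'}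
    {S : X ≃ₗᵢ[ℂ] X} {T : X' ≃ₗᵢ[ℂ] X'} (h : Intertwines f S T) :
    Intertwines f.adjoint T S := by
  refine ContinuousLinearMap.adjoint.injective ?_
  have hS : (toOp S).adjoint = toOp S⁻¹ := S.adjoint_eq_symm
  have hT : (toOp T).adjoint = toOp T⁻¹ := T.adjoint_eq_symm
  simpa only [ContinuousLinearMap.adjoint_comp, ContinuousLinearMap.adjoint_adjoint, hS, hT]
    using h.inv.symm

variable [CompleteSpace A] [CompleteSpace A']

theorem adjoint_map_id (a : A →L[ℂ] A') :
    (map a (.id ℂ B)).adjoint = map a.adjoint (.id ℂ B) := by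
  ext x' y
  refine ext_inner_tmul fun x y' => ?_
  simp [ContinuousLinearMap.adjoint_inner_right, inner_tmul]

theorem adjoint_flip_mkL_comp_map (a : A →L[ℂ] A') (y : B) :
    ((mkL A' B).flip y).adjoint ∘L map a (.id ℂ B) = a ∘L ((mkL A B).flip y).adjoint := by
  apply ContinuousLinearMap.adjoint.injective
  simp only [ContinuousLinearMap.adjoint_comp, ContinuousLinearMap.adjoint_adjoint, adjoint_map_id]
  ext x'
  simp

/-- The condition is linear in the matrix coefficients of `a`, hence weakly continuous. -/
theorem intertwines_map_id_iff {a : A →L[ℂ] A'} {S : HTensor A B ≃ₗᵢ[ℂ] HTensor A B}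
    {T : HTensor A' B ≃ₗᵢ[ℂ] HTensor A' B} :
    Intertwines (map a (.id ℂ B)) S T ↔ ∀ (x : A) (y : B) (x' : A') (y' : B),
      innerSL ℂ x' (a (((mkL A B).flip y').adjoint (S (tmul x y)))) =
        (innerSL ℂ (tmul x' y') ∘L toOp T ∘L (mkL A' B).flip y) (a x) := by
  have hS (x : A) (y : B) (x' : A') (y' : B) :
      innerSL ℂ x' (a (((mkL A B).flip y').adjoint (S (tmul x y)))) =
        inner ℂ (tmul x' y') (map a (.id ℂ B) (S (tmul x y))) := by
    rw [innerSL_apply_apply, ← ContinuousLinearMap.comp_apply, ← adjoint_flip_mkL_comp_map,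
      ContinuousLinearMap.comp_apply, ContinuousLinearMap.adjoint_inner_right]
    rfl
  simp only [hS]
  refine ⟨fun h x y x' y' => by simp [h.apply], fun h => ?_⟩
  ext x y
  exact ext_inner_tmul fun x' y' => by simpa using h x y x' y'

theorem isClosed_setOf_intertwines (S : HTensor A B ≃ₗᵢ[ℂ] HTensor A B)
    (T : HTensor A' B ≃ₗᵢ[ℂ] HTensor A' B) :
    IsClosed {a : A →WOT[ℂ] A' | Intertwines (map a.toCLM (.id ℂ B)) S T} := by
  simp only [intertwines_map_id_iff, Set.ofPred_forall]
  exact isClosed_iInter fun x => isClosed_iInter fun y => isClosed_iInter fun x' =>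
    isClosed_iInter fun y' => isClosed_eq (ContinuousLinearMapWOT.continuous_dual_apply _ _)
      (ContinuousLinearMapWOT.continuous_dual_apply _ _)

end WeakClosedness

section FourLegs

theorem intertwines_assoc_leg14 (T : HTensor A D ≃ₗᵢ[ℂ] HTensor A D) :
    Intertwines (map (toOp (assoc A B C)) (.id ℂ D)) (leg13 C (leg13 B T))
      (leg13 (HTensor B C) T) := by
  simp only [leg13_eq_amplify, amplify_amplify]
  exact (Intertwines.id T).amplify (.id ℂ _) (by ext; simp)

theorem intertwines_assoc_leg24 (T : HTensor B D ≃ₗᵢ[ℂ] HTensor B D) :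
    Intertwines (map (toOp (assoc A B C)) (.id ℂ D)) (leg13 C (leg23 A T))
      (leg23 A (leg13 C T)) := by
  simp only [leg13_eq_amplify, leg23_eq_amplify, amplify_amplify]
  exact (Intertwines.id T).amplify (toOp (flip A C)) (by ext; simp)

theorem intertwines_assoc_leg34 (T : HTensor C D ≃ₗᵢ[ℂ] HTensor C D) :
    Intertwines (map (toOp (assoc A B C)) (.id ℂ D)) (leg23 (HTensor A B) T)
      (leg23 A (leg23 B T)) := by
  simp only [leg23_eq_amplify, amplify_amplify]
  exact (Intertwines.id T).amplify (toOp (flip A B)) (by ext; simp)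

theorem commute_leg12_leg34 (S : HTensor A B ≃ₗᵢ[ℂ] HTensor A B)
    (T : HTensor C D ≃ₗᵢ[ℂ] HTensor C D) :
    Commute (leg12 D (leg12 C S)) (leg23 (HTensor A B) T) := by
  simp only [leg12_eq_amplify, leg23_eq_amplify, amplify_amplify]
  exact commute_amplify (by ext; simp) S T

theorem commute_leg13_leg24 (S : HTensor A C ≃ₗᵢ[ℂ] HTensor A C)
    (T : HTensor B D ≃ₗᵢ[ℂ] HTensor B D) :
    Commute (leg12 D (leg13 B S)) (leg13 C (leg23 A T)) := by
  simp only [leg12_eq_amplify, leg13_eq_amplify, leg23_eq_amplify, amplify_amplify]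
  exact commute_amplify (by ext; simp) S T

theorem commute_leg14_leg23 (S : HTensor A D ≃ₗᵢ[ℂ] HTensor A D)
    (T : HTensor B C ≃ₗᵢ[ℂ] HTensor B C) :
    Commute (leg13 C (leg13 B S)) (leg12 D (leg23 A T)) := by
  simp only [leg12_eq_amplify, leg13_eq_amplify, leg23_eq_amplify, amplify_amplify]
  exact commute_amplify (by ext; simp) S T

theorem leg13_leg12 (T : HTensor A B ≃ₗᵢ[ℂ] HTensor A B) :
    leg13 C (leg12 D T) = leg12 D (leg12 C T) := by
  simp only [leg12_eq_amplify, leg13_eq_amplify, amplify_amplify]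
  exact amplify_eq_amplify (.id T) (toOp (flip D C)) (by ext; simp)

variable (B) in
/-- Leg numbering: `R₁₃₄` on `A ⊗ B ⊗ C ⊗ D`. -/
def leg134 : (HTensor (HTensor A C) D ≃ₗᵢ[ℂ] HTensor (HTensor A C) D) →*
    (HTensor (HTensor (HTensor A B) C) D ≃ₗᵢ[ℂ] HTensor (HTensor (HTensor A B) C) D) :=
  amplify ((rightComm (HTensor A C) D B).trans (congr (rightComm A C B) (.refl ℂ D)))

variable (A) in
/-- Leg numbering: `R₂₃₄` on `A ⊗ B ⊗ C ⊗ D`. -/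
def leg234 : (HTensor (HTensor B C) D ≃ₗᵢ[ℂ] HTensor (HTensor B C) D) →*
    (HTensor (HTensor (HTensor A B) C) D ≃ₗᵢ[ℂ] HTensor (HTensor (HTensor A B) C) D) :=
  amplify ((rotate A (HTensor B C) D).trans (congr (assoc A B C).symm (.refl ℂ D)))

theorem leg134_leg12 (T : HTensor A C ≃ₗᵢ[ℂ] HTensor A C) :
    leg134 B (leg12 D T) = leg12 D (leg13 B T) := by
  simp only [leg134, leg12_eq_amplify, leg13_eq_amplify, amplify_amplify]
  exact amplify_eq_amplify (.id T) (toOp (flip D B)) (by ext; simp)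

theorem leg134_leg13 (T : HTensor A D ≃ₗᵢ[ℂ] HTensor A D) :
    leg134 B (leg13 C T) = leg13 C (leg13 B T) := by
  simp only [leg134, leg13_eq_amplify, amplify_amplify]
  exact amplify_eq_amplify (.id T) (toOp (flip C B)) (by ext; simp)

theorem leg134_leg23 (T : HTensor C D ≃ₗᵢ[ℂ] HTensor C D) :
    leg134 B (leg23 A T) = leg23 (HTensor A B) T := by
  simp only [leg134, leg23_eq_amplify, amplify_amplify]
  exact amplify_eq_amplify (.id T) (.id ℂ _) (by ext; simp)

theorem leg134_injective [Nontrivial B] : Function.Injective (leg134 B : _ →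
    (HTensor (HTensor (HTensor A B) C) D ≃ₗᵢ[ℂ] HTensor (HTensor (HTensor A B) C) D)) :=
  amplify_injective _

theorem leg234_leg12 (T : HTensor B C ≃ₗᵢ[ℂ] HTensor B C) :
    leg234 A (leg12 D T) = leg12 D (leg23 A T) := by
  simp only [leg234, leg12_eq_amplify, leg23_eq_amplify, amplify_amplify]
  exact amplify_eq_amplify (.id T) (toOp (flip D A)) (by ext; simp)

theorem leg234_leg13 (T : HTensor B D ≃ₗᵢ[ℂ] HTensor B D) :
    leg234 A (leg13 C T) = leg13 C (leg23 A T) := by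
  simp only [leg234, leg13_eq_amplify, leg23_eq_amplify, amplify_amplify]
  exact amplify_eq_amplify (.id T) (toOp (flip C A)) (by ext; simp)

theorem leg234_leg23 (T : HTensor C D ≃ₗᵢ[ℂ] HTensor C D) :
    leg234 A (leg23 B T) = leg23 (HTensor A B) T := by
  simp only [leg234, leg23_eq_amplify, amplify_amplify]
  exact amplify_eq_amplify (.id T) (toOp (flip B A)) (by ext; simp)

theorem leg13_conjBy_assoc
    (R : HTensor (HTensor A C) D ≃ₗᵢ[ℂ] HTensor (HTensor A C) D) :
    leg13 B (conjBy (assoc A C D) R) = conjBy (assoc (HTensor A B) C D) (leg134 B R) := by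
  rw [leg13_eq_amplify, leg134]
  exact (amplify_eq_amplify (e' := rightComm A (HTensor C D) B)
    (intertwines_conjBy (assoc A C D) R) (.id ℂ B)
    (e := ((rightComm (HTensor A C) D B).trans (congr (rightComm A C B) (.refl ℂ D))).trans
      (assoc (HTensor A B) C D)) (by ext; simp)).symm

theorem leg23_conjBy_assoc
    (R : HTensor (HTensor B C) D ≃ₗᵢ[ℂ] HTensor (HTensor B C) D) :
    leg23 A (conjBy (assoc B C D) R) = conjBy (assoc (HTensor A B) C D) (leg234 A R) := by
  rw [leg23_eq_amplify, leg234]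
  exact (amplify_eq_amplify (e' := rotate A B (HTensor C D))
    (intertwines_conjBy (assoc B C D) R) (.id ℂ A)
    (e := ((rotate A (HTensor B C) D).trans (congr (assoc A B C).symm (.refl ℂ D))).trans
      (assoc (HTensor A B) C D)) (by ext; simp)).symm

end FourLegs

end

end HTensor

section MixedPentagon

variable {H L K K₁ K₂ : Type*}
  [NormedAddCommGroup H] [InnerProductSpace ℂ H]
  [NormedAddCommGroup L] [InnerProductSpace ℂ L]
  [NormedAddCommGroup K] [InnerProductSpace ℂ K]
  [NormedAddCommGroup K₁] [InnerProductSpace ℂ K₁]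
  [NormedAddCommGroup K₂] [InnerProductSpace ℂ K₂]
  {V : HTensor H L ≃ₗᵢ[ℂ] HTensor H L}

/-- The common shape `V₂₃ S₁₂ = S₁₂ X₁₃ V₂₃` of the pentagon equation and of the equations that
define right and left representations of a multiplicative unitary and the braiding unitary `X⁻¹`. -/
def MixedPentagon (V : HTensor H L ≃ₗᵢ[ℂ] HTensor H L) (S : HTensor K H ≃ₗᵢ[ℂ] HTensor K H)
    (X : HTensor K L ≃ₗᵢ[ℂ] HTensor K L) : Prop :=
  leg23 K V * leg12 L S = leg12 L S * leg13 H X * leg23 K V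

theorem mixedPentagon_iff {S : HTensor K H ≃ₗᵢ[ℂ] HTensor K H}
    {X : HTensor K L ≃ₗᵢ[ℂ] HTensor K L} :
    MixedPentagon V S X ↔
      leg13 H X = (leg12 L S)⁻¹ * leg23 K V * leg12 L S * (leg23 K V)⁻¹ := by
  rw [mul_assoc _ (leg23 K V), eq_mul_inv_iff_mul_eq, eq_inv_mul_iff_mul_eq, ← mul_assoc]
  exact eq_comm

theorem isBraidingUnitary_iff {S : HTensor K H ≃ₗᵢ[ℂ] HTensor K H}
    {Z : HTensor K L ≃ₗᵢ[ℂ] HTensor K L} :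
    IsBraidingUnitary V S Z ↔ MixedPentagon V S Z⁻¹ := by
  rw [IsBraidingUnitary, mixedPentagon_iff, leg13_inv, inv_eq_iff_eq_inv]
  simp only [mul_inv_rev, inv_inv, mul_assoc]

namespace MixedPentagon

theorem one (V : HTensor H L ≃ₗᵢ[ℂ] HTensor H L) :
    MixedPentagon V (1 : HTensor K H ≃ₗᵢ[ℂ] HTensor K H) 1 := by
  rw [MixedPentagon, leg12_one, leg13_one, one_mul, one_mul, mul_one]

variable {S : HTensor K H ≃ₗᵢ[ℂ] HTensor K H} {X : HTensor K L ≃ₗᵢ[ℂ] HTensor K L}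

protected theorem semiconjBy (h : MixedPentagon V S X) :
    SemiconjBy (leg12 L S) (leg13 H X * leg23 K V) (leg23 K V) :=
  (mul_assoc _ _ _).symm.trans h.symm

theorem tensor {S₁ : HTensor K₁ H ≃ₗᵢ[ℂ] HTensor K₁ H} {X₁ : HTensor K₁ L ≃ₗᵢ[ℂ] HTensor K₁ L}
    {S₂ : HTensor K₂ H ≃ₗᵢ[ℂ] HTensor K₂ H} {X₂ : HTensor K₂ L ≃ₗᵢ[ℂ] HTensor K₂ L}
    (h₁ : MixedPentagon V S₁ X₁) (h₂ : MixedPentagon V S₂ X₂) :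
    MixedPentagon V (leg13 K₂ S₁ * leg23 K₁ S₂) (leg13 K₂ X₁ * leg23 K₁ X₂) := by
  have hs₁ := h₁.semiconjBy.map (leg134 K₂)
  have hs₂ := h₂.semiconjBy.map (leg234 K₁)
  simp only [map_mul, leg134_leg12, leg134_leg13, leg134_leg23, leg234_leg12, leg234_leg13,
    leg234_leg23] at hs₁ hs₂
  have hcomm : SemiconjBy (leg12 L (leg23 K₁ S₂)) (leg13 H (leg13 K₂ X₁)) (leg13 H (leg13 K₂ X₁)) :=
    (commute_leg14_leg23 X₁ S₂).symm
  rw [MixedPentagon, leg12_mul, leg13_mul, mul_assoc _ _ (leg23 (HTensor K₁ K₂) V),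
    mul_assoc (leg13 H _)]
  exact (hs₁.mul_left (hcomm.mul_right hs₂)).eq.symm

theorem intertwines [Nontrivial H] {S₁ : HTensor K₁ H ≃ₗᵢ[ℂ] HTensor K₁ H}
    {X₁ : HTensor K₁ L ≃ₗᵢ[ℂ] HTensor K₁ L} {S₂ : HTensor K₂ H ≃ₗᵢ[ℂ] HTensor K₂ H}
    {X₂ : HTensor K₂ L ≃ₗᵢ[ℂ] HTensor K₂ L} (h₁ : MixedPentagon V S₁ X₁)
    (h₂ : MixedPentagon V S₂ X₂) {a : K₁ →L[ℂ] K₂}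
    (ha : Intertwines (map a (.id ℂ H)) S₁ S₂) : Intertwines (map a (.id ℂ L)) X₁ X₂ := by
  have hS := ha.leg12 (.id ℂ L)
  have hV : Intertwines (map (map a (.id ℂ H)) (.id ℂ L)) (leg23 K₁ V) (leg23 K₂ V) :=
    Intertwines.leg23 (by rw [map_id_id]; exact .id V) a
  refine Intertwines.of_leg13 (B := H) ?_
  rw [mixedPentagon_iff.mp h₁, mixedPentagon_iff.mp h₂]
  exact ((hS.inv.mul hV).mul hS).mul hV.inv

theorem unique [Nontrivial H] {X' : HTensor K L ≃ₗᵢ[ℂ] HTensor K L} (h : MixedPentagon V S X)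
    (h' : MixedPentagon V S X') : X = X' :=
  leg13_injective ((mixedPentagon_iff.mp h).trans (mixedPentagon_iff.mp h').symm)

theorem hasBraiding (h : MixedPentagon V S X) : HasBraiding V S :=
  ⟨X⁻¹, isBraidingUnitary_iff.mpr (by rwa [inv_inv])⟩

/-- On `K ⊗ H ⊗ L ⊗ H`, conjugate `W₂₄ U₃₄` and its image `U₃₄ W₂₄` under `V₂₃` by `S₁₂`, which
inserts `S₁₄` in front of `W₂₄`. -/
theorem equivariant [Nontrivial H] {W : HTensor H H ≃ₗᵢ[ℂ] HTensor H H}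
    {U : HTensor L H ≃ₗᵢ[ℂ] HTensor L H} (hX : MixedPentagon V S X) (hS : IsRightRep W S)
    (hU : leg12 H V * leg13 L W * leg23 H U = leg23 H U * leg13 L W * leg12 H V) :
    leg12 H X * (leg13 L S * leg23 K U) = leg23 K U * leg13 L S * leg12 H X := by
  have hx := congrArg (leg12 H) (mixedPentagon_iff.mp hX)
  have hs := congrArg (leg13 L) (MixedPentagon.semiconjBy hS).eq
  have hv := congrArg (leg234 K) hU
  simp only [leg12_mul, leg12_inv, leg13_mul, map_mul, leg13_leg12, leg234_leg12, leg234_leg13,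
    leg234_leg23] at hx hs hv
  apply leg134_injective (B := H)
  simp only [map_mul, leg134_leg12, leg134_leg13, leg134_leg23]
  have hsu := commute_leg12_leg34 S U
  have hvs := commute_leg14_leg23 S V
  have hxw := commute_leg13_leg24 X W
  generalize leg12 H (leg12 L S) = s at *
  generalize leg12 H (leg23 K V) = v at *
  generalize leg12 H (leg13 H X) = x at *
  generalize leg13 L (leg23 K W) = w at *
  generalize leg13 L (leg13 H S) = s₁₄ at *
  generalize leg23 (HTensor K H) U = u at *
  have h₁ : SemiconjBy s (s₁₄ * w * u) (w * u) := SemiconjBy.mul_right hs hsu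
  have h₂ : SemiconjBy v (w * u) (u * w) := by rw [SemiconjBy, ← mul_assoc, hv]
  have h₃ : SemiconjBy s⁻¹ (u * w) (u * (s₁₄ * w)) :=
    (SemiconjBy.mul_right hsu hs).inv_symm_left
  have h₄ : SemiconjBy v⁻¹ (s₁₄ * (u * w)) (s₁₄ * (w * u)) :=
    (SemiconjBy.mul_right hvs.symm h₂).inv_symm_left
  have h : SemiconjBy x (s₁₄ * (u * w)) (u * (s₁₄ * w)) := by
    rw [hx]
    exact ((h₃.mul_left h₂).mul_left h₁).mul_left (by rwa [mul_assoc s₁₄])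
  rw [← mul_left_inj w]
  simpa [mul_assoc, hxw.eq] using h.eq

theorem commute_leg23 [Nontrivial H] {F : HTensor L L ≃ₗᵢ[ℂ] HTensor L L}
    (hX : MixedPentagon V S X)
    (hF : leg13 L V * leg12 L V * leg23 H F = leg23 H F * (leg13 L V * leg12 L V)) :
    Commute (leg23 K F) (leg13 L X * leg12 L X) := by
  have hx₃ := congrArg (leg12 L) (mixedPentagon_iff.mp hX)
  have hx₄ := congrArg (leg13 L) (mixedPentagon_iff.mp hX)
  have hv := congrArg (leg234 K) hF
  simp only [leg12_mul, leg12_inv, leg13_mul, leg13_inv, map_mul, leg13_leg12, leg234_leg12,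
    leg234_leg13, leg234_leg23] at hx₃ hx₄ hv
  apply leg134_injective (B := H)
  simp only [map_mul, leg134_leg12, leg134_leg13, leg134_leg23]
  have hsf := commute_leg12_leg34 S F
  have hxv := commute_leg13_leg24 X V
  generalize leg12 L (leg12 L S) = s at *
  generalize leg12 L (leg23 K V) = v₃ at *
  generalize leg13 L (leg23 K V) = v₄ at *
  generalize leg12 L (leg13 H X) = x₃ at *
  generalize leg13 L (leg13 H X) = x₄ at *
  generalize leg23 (HTensor K H) F = f at *
  have hxx : x₄ * x₃ = s⁻¹ * (v₄ * v₃) * s * (v₄ * v₃)⁻¹ := by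
    calc x₄ * x₃ = s⁻¹ * v₄ * s * (v₄⁻¹ * x₃) := by rw [hx₄, mul_assoc]
      _ = s⁻¹ * v₄ * s * (x₃ * v₄⁻¹) := by rw [hxv.inv_right.eq]
      _ = s⁻¹ * (v₄ * v₃) * s * (v₄ * v₃)⁻¹ := by rw [hx₃]; group
  have hfs : Commute f s := hsf.symm
  have hfv : Commute f (v₄ * v₃) := hv.symm
  rw [hxx]
  exact ((hfs.inv_right.mul_right hfv).mul_right hfs).mul_right hfv.inv_right

end MixedPentagon

theorem mixedPentagon_braidingUnitary {S : HTensor K H ≃ₗᵢ[ℂ] HTensor K H}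
    (h : HasBraiding V S) : MixedPentagon V S (braidingUnitary V S)⁻¹ := by
  rw [braidingUnitary, dif_pos h]
  exact isBraidingUnitary_iff.mp h.choose_spec

theorem MixedPentagon.braidingUnitary_eq [Nontrivial H] {S : HTensor K H ≃ₗᵢ[ℂ] HTensor K H}
    {X : HTensor K L ≃ₗᵢ[ℂ] HTensor K L} (h : MixedPentagon V S X) :
    braidingUnitary V S = X⁻¹ :=
  inv_eq_iff_eq_inv.mp ((mixedPentagon_braidingUnitary h.hasBraiding).unique h)

theorem HasBraiding.tensor {S₁ : HTensor K₁ H ≃ₗᵢ[ℂ] HTensor K₁ H}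
    {S₂ : HTensor K₂ H ≃ₗᵢ[ℂ] HTensor K₂ H} (h₁ : HasBraiding V S₁) (h₂ : HasBraiding V S₂) :
    HasBraiding V (leg13 K₂ S₁ * leg23 K₁ S₂) :=
  ((mixedPentagon_braidingUnitary h₁).tensor (mixedPentagon_braidingUnitary h₂)).hasBraiding

theorem braidingUnitary_tensor [Nontrivial H] {S₁ : HTensor K₁ H ≃ₗᵢ[ℂ] HTensor K₁ H}
    {S₂ : HTensor K₂ H ≃ₗᵢ[ℂ] HTensor K₂ H} (h₁ : HasBraiding V S₁) (h₂ : HasBraiding V S₂) :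
    braidingUnitary V (leg13 K₂ S₁ * leg23 K₁ S₂) =
      leg23 K₁ (braidingUnitary V S₂) * leg13 K₂ (braidingUnitary V S₁) := by
  rw [((mixedPentagon_braidingUnitary h₁).tensor
    (mixedPentagon_braidingUnitary h₂)).braidingUnitary_eq]
  simp only [leg13_inv, leg23_inv, mul_inv_rev, inv_inv]

end MixedPentagon

namespace BraidedMultiplicativeUnitary

noncomputable section

variable {H L K K₁ K₂ K₃ K₁' K₂' Y : Type u}
  [NormedAddCommGroup H] [InnerProductSpace ℂ H]
  [NormedAddCommGroup L] [InnerProductSpace ℂ L]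
  [NormedAddCommGroup K] [InnerProductSpace ℂ K]
  [NormedAddCommGroup K₁] [InnerProductSpace ℂ K₁]
  [NormedAddCommGroup K₂] [InnerProductSpace ℂ K₂]
  [NormedAddCommGroup K₃] [InnerProductSpace ℂ K₃]
  [NormedAddCommGroup K₁'] [InnerProductSpace ℂ K₁']
  [NormedAddCommGroup K₂'] [InnerProductSpace ℂ K₂']
  [NormedAddCommGroup Y] [InnerProductSpace ℂ Y]
  {B : BraidedMultiplicativeUnitary H L}

theorem tensorRep_T (x₁ : B.PreRep K₁) (x₂ : B.PreRep K₂) :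
    (B.tensorRep x₁ x₂).T = leg23 K₁ (braidingUnitary B.V x₂.S) * leg13 K₂ x₁.T *
      (leg23 K₁ (braidingUnitary B.V x₂.S))⁻¹ * leg23 K₁ x₂.T :=
  congrArg (· * leg23 K₁ x₂.T) (conjBy_leg23_flip_trans _ _)

/-- The pair `(S, 1)`; the trivial representations and `(H, W, 1)` are of this form. -/
def ofRightRep (B : BraidedMultiplicativeUnitary H L) (S : HTensor K H ≃ₗᵢ[ℂ] HTensor K H) :
    B.PreRep K :=
  ⟨S, 1⟩

theorem tensorRep_ofRightRep (S₁ : HTensor K₁ H ≃ₗᵢ[ℂ] HTensor K₁ H)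
    (S₂ : HTensor K₂ H ≃ₗᵢ[ℂ] HTensor K₂ H) :
    B.tensorRep (B.ofRightRep S₁) (B.ofRightRep S₂) =
      B.ofRightRep (leg13 K₂ S₁ * leg23 K₁ S₂) := by
  refine PreRep.ext rfl ?_
  rw [tensorRep_T]
  simp only [ofRightRep, leg13_one, leg23_one, mul_one, mul_inv_cancel]

theorem isRep_ofRightRep {S : HTensor K H ≃ₗᵢ[ℂ] HTensor K H} (hS : IsRightRep B.W S)
    (hZ : HasBraiding B.V S) : B.IsRep (B.ofRightRep S) where
  rightRep := hS
  hasBraiding := hZ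
  equivariant := by simp only [ofRightRep, leg12_one, one_mul, mul_one]
  braidedRep := by simp only [ofRightRep, leg12_one, conjBy_one, one_mul, mul_one]

theorem isRep_braidedRegularRep : B.IsRep B.braidedRegularRep :=
  ⟨B.rightRep, B.hasBraiding, B.equivariant_right, B.braidedPentagon⟩

theorem isRep_regularRep : B.IsRep B.regularRep :=
  isRep_ofRightRep B.pentagon (MixedPentagon.hasBraiding B.leftRep)

section Intertwiner

variable {x : B.PreRep K} {x₁ : B.PreRep K₁} {x₂ : B.PreRep K₂} {x₃ : B.PreRep K₃}
  {x₁' : B.PreRep K₁'} {x₂' : B.PreRep K₂'}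

theorem mem_intertwiner {a : K₁ →L[ℂ] K₂} : a ∈ B.Intertwiner x₁ x₂ ↔
    Intertwines (map a (.id ℂ H)) x₁.S x₂.S ∧ Intertwines (map a (.id ℂ L)) x₁.T x₂.T :=
  Iff.rfl

theorem id_mem_intertwiner (x : B.PreRep K) : .id ℂ K ∈ B.Intertwiner x x := by
  rw [mem_intertwiner, map_id_id, map_id_id]
  exact ⟨.id _, .id _⟩

theorem eq_of_id_mem_intertwiner {x' : B.PreRep K} (h : .id ℂ K ∈ B.Intertwiner x x') :
    x = x' := by
  rw [mem_intertwiner, map_id_id, map_id_id] at h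
  exact PreRep.ext (toOp_injective h.1) (toOp_injective h.2)

variable (x₁ x₂) in
/-- The space of arrows `x₁ → x₂`, as a linear subspace of the bounded operators. -/
def intertwinerSubmodule : Submodule ℂ (K₁ →L[ℂ] K₂) where
  carrier := B.Intertwiner x₁ x₂
  zero_mem' := by
    rw [mem_intertwiner, zero_map, zero_map]
    exact ⟨.zero _ _, .zero _ _⟩
  add_mem' ha hb := by
    rw [mem_intertwiner, add_map, add_map]
    exact ⟨Intertwines.add ha.1 hb.1, Intertwines.add ha.2 hb.2⟩
  smul_mem' c _ ha := by
    rw [mem_intertwiner, smul_map, smul_map]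
    exact ⟨Intertwines.smul c ha.1, Intertwines.smul c ha.2⟩

theorem comp_mem_intertwiner {a : K₁ →L[ℂ] K₂} {b : K₂ →L[ℂ] K₃}
    (hb : b ∈ B.Intertwiner x₂ x₃) (ha : a ∈ B.Intertwiner x₁ x₂) :
    b ∘L a ∈ B.Intertwiner x₁ x₃ := by
  have hS := Intertwines.comp hb.1 ha.1
  have hT := Intertwines.comp hb.2 ha.2
  rw [map_comp_map] at hS hT
  exact ⟨hS, hT⟩

theorem symm_mem_intertwiner {R : K₁ ≃ₗᵢ[ℂ] K₂} (h : toOp R ∈ B.Intertwiner x₁ x₂) :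
    toOp R.symm ∈ B.Intertwiner x₂ x₁ := by
  have hR : toOp R ∘L toOp R.symm = .id ℂ K₂ := by ext; simp
  have hR' : toOp R.symm ∘L toOp R = .id ℂ K₁ := by ext; simp
  exact ⟨Intertwines.of_inverse h.1 (by rw [map_comp_map, hR, ContinuousLinearMap.comp_id,
      map_id_id]) (by rw [map_comp_map, hR', ContinuousLinearMap.comp_id, map_id_id]),
    Intertwines.of_inverse h.2 (by rw [map_comp_map, hR, ContinuousLinearMap.comp_id,
      map_id_id]) (by rw [map_comp_map, hR', ContinuousLinearMap.comp_id, map_id_id])⟩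

theorem adjoint_mem_intertwiner [CompleteSpace K₁] [CompleteSpace K₂] {a : K₁ →L[ℂ] K₂}
    (ha : a ∈ B.Intertwiner x₁ x₂) : a.adjoint ∈ B.Intertwiner x₂ x₁ := by
  rw [mem_intertwiner, ← adjoint_map_id, ← adjoint_map_id]
  exact ⟨Intertwines.adjoint ha.1, Intertwines.adjoint ha.2⟩

theorem map_mem_intertwiner [Nontrivial H] (h₂ : HasBraiding B.V x₂.S)
    (h₂' : HasBraiding B.V x₂'.S) {a : K₁ →L[ℂ] K₁'} {b : K₂ →L[ℂ] K₂'}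
    (ha : a ∈ B.Intertwiner x₁ x₁') (hb : b ∈ B.Intertwiner x₂ x₂') :
    map a b ∈ B.Intertwiner (B.tensorRep x₁ x₂) (B.tensorRep x₁' x₂') := by
  have hZ : Intertwines (map b (.id ℂ L)) (braidingUnitary B.V x₂.S)
      (braidingUnitary B.V x₂'.S) :=
    ((mixedPentagon_braidingUnitary h₂).intertwines
      (mixedPentagon_braidingUnitary h₂') hb.1).inv
  rw [mem_intertwiner, tensorRep_T, tensorRep_T]
  exact ⟨(Intertwines.leg13 ha.1 b).mul (Intertwines.leg23 hb.1 a),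
    (((hZ.leg23 a).mul (Intertwines.leg13 ha.2 b)).mul (hZ.leg23 a).inv).mul
      (Intertwines.leg23 hb.2 a)⟩

theorem assoc_mem_intertwiner [Nontrivial H] (h₂ : HasBraiding B.V x₂.S)
    (h₃ : HasBraiding B.V x₃.S) :
    toOp (assoc K₁ K₂ K₃) ∈ B.Intertwiner (B.tensorRep (B.tensorRep x₁ x₂) x₃)
      (B.tensorRep x₁ (B.tensorRep x₂ x₃)) := by
  have hZ : braidingUnitary B.V (B.tensorRep x₂ x₃).S =
      leg23 K₂ (braidingUnitary B.V x₃.S) * leg13 K₃ (braidingUnitary B.V x₂.S) :=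
    braidingUnitary_tensor h₂ h₃
  have hS := (intertwines_assoc_leg14 (B := K₂) (C := K₃) x₁.S).mul
    ((intertwines_assoc_leg24 (A := K₁) (C := K₃) x₂.S).mul
      (intertwines_assoc_leg34 (A := K₁) (B := K₂) x₃.S))
  have z₃ := intertwines_assoc_leg34 (A := K₁) (B := K₂) (braidingUnitary B.V x₃.S)
  have z₂ := intertwines_assoc_leg24 (A := K₁) (C := K₃) (braidingUnitary B.V x₂.S)
  have t₁ := intertwines_assoc_leg14 (B := K₂) (C := K₃) x₁.T
  have t₂ := intertwines_assoc_leg24 (A := K₁) (C := K₃) x₂.T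
  have t₃ := intertwines_assoc_leg34 (A := K₁) (B := K₂) x₃.T
  have hT := z₃.mul (z₂.mul (t₁.mul (z₂.inv.mul (t₂.mul (z₃.inv.mul t₃)))))
  rw [mem_intertwiner, tensorRep_T, tensorRep_T, tensorRep_T, tensorRep_T, hZ]
  constructor
  · simpa only [tensorRep, leg13_mul, leg23_mul, mul_assoc] using hS
  · simpa only [leg13_mul, leg23_mul, leg13_inv, leg23_inv, mul_inv_rev, mul_assoc,
      inv_mul_cancel_left] using hT

theorem leg12_mem_intertwiner [Nontrivial H] {y : B.PreRep (HTensor K₁ K₂)}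
    {y' : B.PreRep (HTensor K₁' K₂')} (h₃ : HasBraiding B.V x₃.S)
    {R : HTensor K₁ K₂ ≃ₗᵢ[ℂ] HTensor K₁' K₂'} (hR : toOp R ∈ B.Intertwiner y y') :
    toOp (leg12 K₃ R) ∈ B.Intertwiner (B.tensorRep y x₃) (B.tensorRep y' x₃) := by
  rw [toOp_leg12]
  exact map_mem_intertwiner h₃ h₃ hR (id_mem_intertwiner x₃)

theorem leg23_mem_intertwiner [Nontrivial H] (h₁ : HasBraiding B.V x₁.S)
    (h₂ : HasBraiding B.V x₂.S) (h₁' : HasBraiding B.V x₁'.S) (h₂' : HasBraiding B.V x₂'.S)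
    {R : HTensor K₁ K₂ ≃ₗᵢ[ℂ] HTensor K₁' K₂'}
    (hR : toOp R ∈ B.Intertwiner (B.tensorRep x₁ x₂) (B.tensorRep x₁' x₂')) :
    toOp (leg23 K R) ∈ B.Intertwiner (B.tensorRep (B.tensorRep x x₁) x₂)
      (B.tensorRep (B.tensorRep x x₁') x₂') := by
  have h₁₂ : HasBraiding B.V (B.tensorRep x₁ x₂).S := h₁.tensor h₂
  have h₁₂' : HasBraiding B.V (B.tensorRep x₁' x₂').S := h₁'.tensor h₂'
  have h : toOp (leg23 K R) = toOp (assoc K K₁' K₂').symm ∘L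
      map (.id ℂ K) (toOp R) ∘L toOp (assoc K K₁ K₂) := by
    ext; simp [leg23]
  rw [h]
  exact comp_mem_intertwiner (symm_mem_intertwiner (assoc_mem_intertwiner h₁' h₂'))
    (comp_mem_intertwiner (map_mem_intertwiner h₁₂ h₁₂' (id_mem_intertwiner x) hR)
      (assoc_mem_intertwiner h₁ h₂))

end Intertwiner

theorem tensorRep_ofRightRep_left_T (S : HTensor K₁ H ≃ₗᵢ[ℂ] HTensor K₁ H) (x : B.PreRep K₂) :
    (B.tensorRep (B.ofRightRep S) x).T = leg23 K₁ x.T := by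
  rw [tensorRep_T, ofRightRep, leg13_one, mul_one, mul_inv_cancel, one_mul]

theorem tensorRep_ofRightRep_right_T (x : B.PreRep K₁) (S : HTensor K₂ H ≃ₗᵢ[ℂ] HTensor K₂ H) :
    (B.tensorRep x (B.ofRightRep S)).T = leg23 K₁ (braidingUnitary B.V S) * leg13 K₂ x.T *
      (leg23 K₁ (braidingUnitary B.V S))⁻¹ := by
  rw [tensorRep_T, ofRightRep, leg23_one, mul_one]

theorem braiding_mem_intertwiner [Nontrivial H] {S : HTensor K H ≃ₗᵢ[ℂ] HTensor K H}
    (hS : IsRightRep B.W S) (hZ : HasBraiding B.V S) :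
    toOp (braiding B.V S) ∈ B.Intertwiner (B.tensorRep B.braidedRegularRep (B.ofRightRep S))
      (B.tensorRep (B.ofRightRep S) B.braidedRegularRep) := by
  set Z := braidingUnitary B.V S with hZdef
  have hX : MixedPentagon B.V S Z⁻¹ := mixedPentagon_braidingUnitary hZ
  have hc (D : Type u) [NormedAddCommGroup D] [InnerProductSpace ℂ D] :
      map (toOp (braiding B.V S)) (.id ℂ D) =
        toOp (leg12 D Z) ∘L map (toOp (HTensor.flip L K)) (.id ℂ D) := by
    ext; simp [braiding, leg12, hZdef]
  have hequiv : SemiconjBy (leg12 H Z) (leg23 K B.U * leg13 L S) (leg13 L S * leg23 K B.U) := by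
    have h : SemiconjBy (leg12 H Z)⁻¹ (leg13 L S * leg23 K B.U) (leg23 K B.U * leg13 L S) := by
      rw [SemiconjBy, ← leg12_inv]
      exact hX.equivariant hS B.yetterDrinfeld
    simpa only [inv_inv] using h.inv_symm_left
  have hcomm : SemiconjBy (leg12 L Z) (leg13 L Z * leg23 K B.F * (leg13 L Z)⁻¹) (leg23 K B.F) := by
    have h := hX.commute_leg23 B.equivariant_left
    rw [leg12_inv, leg13_inv, ← mul_inv_rev, Commute.inv_right_iff] at h
    rw [SemiconjBy, ← mul_assoc, ← mul_assoc, ← h.eq, ← mul_assoc, mul_inv_cancel_right]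
  rw [mem_intertwiner, hc, hc, tensorRep_ofRightRep_left_T, tensorRep_ofRightRep_right_T]
  exact ⟨(intertwines_toOp_iff.mpr hequiv).comp
      ((intertwines_flip_leg13 B.U).mul (intertwines_flip_leg23 S)),
    (intertwines_toOp_iff.mpr hcomm).comp (((intertwines_flip_leg23 Z).mul
      (intertwines_flip_leg13 B.F)).mul (intertwines_flip_leg23 Z).inv)⟩

theorem isRep_iff {x : B.PreRep K} : B.IsRep x ↔ IsRightRep B.W x.S ∧ HasBraiding B.V x.S ∧
    toOp x.T ∈ B.Intertwiner (B.tensorRep x B.braidedRegularRep)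
      (B.tensorRep (B.ofRightRep x.S) B.braidedRegularRep) := by
  rw [mem_intertwiner, tensorRep_ofRightRep_left_T, ← toOp_leg12, ← toOp_leg12,
    intertwines_toOp_iff, intertwines_toOp_iff]
  refine ⟨fun h => ⟨h.rightRep, h.hasBraiding, h.equivariant.symm, ?_⟩,
    fun ⟨hS, hZ, hequiv, hbraid⟩ => ⟨hS, hZ, hequiv.eq.symm, ?_⟩⟩
  · rw [SemiconjBy]
    exact (mul_assoc _ _ _).symm.trans h.braidedRep.symm
  · exact hbraid.eq.symm.trans (mul_assoc _ _ _).symm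

theorem IsRep.tensor [Nontrivial H] {x₁ : B.PreRep K₁} {x₂ : B.PreRep K₂} (h₁ : B.IsRep x₁)
    (h₂ : B.IsRep x₂) : B.IsRep (B.tensorRep x₁ x₂) := by
  obtain ⟨hS₁, hZ₁, hT₁⟩ := isRep_iff.mp h₁
  obtain ⟨hS₂, hZ₂, hT₂⟩ := isRep_iff.mp h₂
  have hZL : HasBraiding B.V B.braidedRegularRep.S := B.hasBraiding
  have hZ₂' : HasBraiding B.V (B.ofRightRep x₂.S).S := hZ₂
  have hS : IsRightRep B.W (B.tensorRep x₁ x₂).S := MixedPentagon.tensor hS₁ hS₂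
  have hc := braiding_mem_intertwiner hS₂ hZ₂
  have hcleg (x : B.PreRep K₁) := leg23_mem_intertwiner (x := x) hZL hZ₂' hZ₂' hZL hc
  have hT := comp_mem_intertwiner (hcleg (B.ofRightRep x₁.S)) (comp_mem_intertwiner
    (leg12_mem_intertwiner hZ₂' hT₁) (comp_mem_intertwiner (symm_mem_intertwiner (hcleg x₁))
      (leg23_mem_intertwiner hZ₂ hZL hZ₂' hZL hT₂)))
  rw [tensorRep_ofRightRep] at hT
  exact isRep_iff.mpr ⟨hS, hZ₁.tensor hZ₂, hT⟩

theorem isRep_ofRightRep_one : B.IsRep (B.ofRightRep (1 : HTensor K H ≃ₗᵢ[ℂ] HTensor K H)) :=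
  isRep_ofRightRep (MixedPentagon.one B.W) (MixedPentagon.one B.V).hasBraiding

theorem tmul_mem_intertwiner_left (x : B.PreRep K) (ξ : Y) :
    mkL Y K ξ ∈ B.Intertwiner x (B.tensorRep (B.ofRightRep 1) x) := by
  rw [mem_intertwiner, tensorRep_ofRightRep_left_T, tensorRep, ofRightRep, leg13_one, one_mul]
  exact ⟨intertwines_tmul_leg23 x.S ξ, intertwines_tmul_leg23 x.T ξ⟩

theorem tmul_mem_intertwiner_right [Nontrivial H] (x : B.PreRep K) (ξ : Y) :
    (mkL K Y).flip ξ ∈ B.Intertwiner x (B.tensorRep x (B.ofRightRep 1)) := by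
  have hZ : braidingUnitary B.V (1 : HTensor Y H ≃ₗᵢ[ℂ] HTensor Y H) = 1 := by
    rw [(MixedPentagon.one B.V).braidingUnitary_eq, inv_one]
  rw [mem_intertwiner, tensorRep_ofRightRep_right_T, hZ, leg23_one, one_mul, inv_one, mul_one,
    tensorRep, ofRightRep, leg23_one, mul_one]
  exact ⟨intertwines_tmul_leg13 x.S ξ, intertwines_tmul_leg13 x.T ξ⟩

theorem mem_intertwiner_of_map_id [Nontrivial Y] {x₁ : B.PreRep K₁} {x₂ : B.PreRep K₂}
    {y : B.PreRep Y} {a : K₁ →L[ℂ] K₂}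
    (h : map a (.id ℂ Y) ∈ B.Intertwiner (B.tensorRep x₁ y) (B.tensorRep x₂ y)) :
    a ∈ B.Intertwiner x₁ x₂ := by
  have hid (D : Type u) [NormedAddCommGroup D] [InnerProductSpace ℂ D]
      (R : HTensor Y D ≃ₗᵢ[ℂ] HTensor Y D) :
      Intertwines (map (map a (.id ℂ Y)) (.id ℂ D)) (leg23 K₁ R) (leg23 K₂ R) :=
    Intertwines.leg23 (by rw [map_id_id]; exact .id R) a
  obtain ⟨hS, hT⟩ := h
  rw [tensorRep_T, tensorRep_T] at hT
  have hZ := hid L (braidingUnitary B.V y.S)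
  have hS' := Intertwines.mul hS (hid H y.S).inv
  have hT' := hZ.inv.mul ((Intertwines.mul hT (hid L y.T).inv).mul hZ)
  simp only [tensorRep, mul_inv_cancel_right] at hS'
  simp only [mul_inv_cancel_right, inv_mul_cancel_right, inv_mul_cancel_left] at hT'
  exact ⟨hS'.of_leg13, hT'.of_leg13⟩

theorem mem_intertwiner_of_id_map [Nontrivial H] [Nontrivial Y] {x₁ : B.PreRep K₁}
    {x₂ : B.PreRep K₂} {y : B.PreRep Y} {a : K₁ →L[ℂ] K₂} (h₁ : HasBraiding B.V x₁.S)
    (h₂ : HasBraiding B.V x₂.S)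
    (h : map (.id ℂ Y) a ∈ B.Intertwiner (B.tensorRep y x₁) (B.tensorRep y x₂)) :
    a ∈ B.Intertwiner x₁ x₂ := by
  have hid (D : Type u) [NormedAddCommGroup D] [InnerProductSpace ℂ D]
      (R : HTensor Y D ≃ₗᵢ[ℂ] HTensor Y D) :
      Intertwines (map (map (.id ℂ Y) a) (.id ℂ D)) (leg13 K₁ R) (leg13 K₂ R) :=
    Intertwines.leg13 (by rw [map_id_id]; exact .id R) a
  obtain ⟨hS, hT⟩ := h
  have hS' := (hid H y.S).inv.mul hS
  simp only [tensorRep, inv_mul_cancel_left] at hS'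
  have haS : Intertwines (map a (.id ℂ H)) x₁.S x₂.S := hS'.of_leg23
  have hZ : Intertwines (map a (.id ℂ L)) (braidingUnitary B.V x₁.S)
      (braidingUnitary B.V x₂.S) :=
    ((mixedPentagon_braidingUnitary h₁).intertwines (mixedPentagon_braidingUnitary h₂) haS).inv
  have hZ' := hZ.leg23 (.id ℂ Y)
  rw [tensorRep_T, tensorRep_T] at hT
  have hT' := ((hZ'.mul (hid L y.T)).mul hZ'.inv).inv.mul hT
  simp only [inv_mul_cancel_left] at hT'
  exact ⟨haS, hT'.of_leg23⟩

theorem toOp_S_mem_intertwiner {x : B.PreRep K} (hS : IsRightRep B.W x.S) :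
    toOp x.S ∈ B.Intertwiner (B.ofRightRep (B.tensorRep x B.regularRep).S)
      (B.tensorRep (B.ofRightRep 1) B.regularRep) := by
  have htriv : B.tensorRep (B.ofRightRep 1) B.regularRep =
      B.ofRightRep (K := HTensor K H) (leg23 K B.W) := by
    rw [show B.regularRep = B.ofRightRep B.W from rfl, tensorRep_ofRightRep, leg13_one, one_mul]
  rw [htriv, mem_intertwiner, ← toOp_leg12, intertwines_toOp_iff]
  exact ⟨MixedPentagon.semiconjBy hS, .one _⟩

theorem toOp_absorbing_mem_intertwiner [Nontrivial H] {x : B.PreRep K} (hx : B.IsRep x) :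
    toOp (B.absorbing x) ∈
      B.Intertwiner (B.tensorRep x B.absorber) (B.tensorRep (B.ofRightRep 1) B.absorber) := by
  have hH : HasBraiding B.V B.regularRep.S := isRep_regularRep.hasBraiding
  have hL : HasBraiding B.V B.braidedRegularRep.S := B.hasBraiding
  have hT := (isRep_iff.mp (hx.tensor isRep_regularRep)).2.2
  have hS := leg12_mem_intertwiner hL (toOp_S_mem_intertwiner hx.rightRep)
  have hcomp : toOp (B.absorbing x) = toOp (assoc K H L) ∘L
      (toOp (leg12 L x.S) ∘L toOp (B.tensorRep x B.regularRep).T) ∘L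
        toOp (assoc K H L).symm := rfl
  rw [hcomp, absorber]
  exact comp_mem_intertwiner (assoc_mem_intertwiner hH hL) (comp_mem_intertwiner
    (comp_mem_intertwiner hS hT) (symm_mem_intertwiner (assoc_mem_intertwiner hH hL)))

theorem absorbing_natural [Nontrivial H] {x₁ : B.PreRep K₁} {x₂ : B.PreRep K₂} {a : K₁ →L[ℂ] K₂}
    (ha : a ∈ B.Intertwiner x₁ x₂) :
    Intertwines (map a (.id ℂ (HTensor H L))) (B.absorbing x₁) (B.absorbing x₂) := by
  have hH : HasBraiding B.V B.regularRep.S := isRep_regularRep.hasBraiding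
  have hT := (map_mem_intertwiner hH hH ha (id_mem_intertwiner B.regularRep)).2
  exact ((Intertwines.leg12 ha.1 (.id ℂ L)).mul hT).conjBy (by ext; simp)

theorem absorbing_eq [Nontrivial H] (x : B.PreRep K) : B.absorbing x =
    conjBy (assoc K H L) (leg12 L x.S * ((leg23 K B.V)⁻¹ * leg13 H x.T * leg23 K B.V)) := by
  have hV : braidingUnitary B.V B.regularRep.S = B.V⁻¹ :=
    MixedPentagon.braidingUnitary_eq B.leftRep
  have hT : B.regularRep.T = 1 := rfl
  rw [absorbing, tensorRep_T, hV, hT, leg23_one, mul_one, leg23_inv, inv_inv]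

theorem absorbing_tensorRep [Nontrivial H] {x₁ : B.PreRep K₁} {x₂ : B.PreRep K₂}
    (h₂ : HasBraiding B.V x₂.S) :
    B.absorbing (B.tensorRep x₁ x₂) = leg13 K₂ (B.absorbing x₁) * leg23 K₁ (B.absorbing x₂) := by
  have hvs := congrArg (leg234 K₁) (mixedPentagon_braidingUnitary h₂)
  have hts := commute_leg14_leg23 (C := H) (D := L) x₁.T x₂.S
  simp only [absorbing_eq, leg13_conjBy_assoc, leg23_conjBy_assoc, ← conjBy_mul, tensorRep_T]
  refine congrArg _ ?_
  simp only [tensorRep, map_mul, map_inv, leg134_leg12, leg134_leg13, leg134_leg23, leg234_leg12,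
    leg234_leg13, leg234_leg23, leg12_mul, leg13_mul, leg13_inv] at hvs ⊢
  generalize leg12 L (leg13 K₂ x₁.S) = s₁
  generalize leg12 L (leg23 K₁ x₂.S) = s₂ at *
  generalize leg23 (HTensor K₁ K₂) B.V = v at *
  generalize leg13 H (leg13 K₂ x₁.T) = t₁ at *
  generalize leg13 H (leg23 K₁ x₂.T) = t₂
  generalize leg13 H (leg23 K₁ (braidingUnitary B.V x₂.S)) = z at *
  have hz : s₂ * z⁻¹ = v * s₂ * v⁻¹ := eq_mul_inv_of_mul_eq hvs.symm
  have hz' : s₂ * v⁻¹ * z = v⁻¹ * s₂ := by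
    calc s₂ * v⁻¹ * z = v⁻¹ * (v * s₂ * v⁻¹) * z := by group
      _ = v⁻¹ * s₂ := by rw [← hz]; group
  calc s₁ * s₂ * (v⁻¹ * (z * t₁ * z⁻¹ * t₂) * v)
      = s₁ * (s₂ * v⁻¹ * z) * t₁ * z⁻¹ * t₂ * v := by group
    _ = s₁ * v⁻¹ * (s₂ * t₁) * z⁻¹ * t₂ * v := by rw [hz']; group
    _ = s₁ * v⁻¹ * t₁ * (s₂ * z⁻¹) * t₂ * v := by rw [← hts.eq]; group
    _ = s₁ * (v⁻¹ * t₁ * v) * (s₂ * (v⁻¹ * t₂ * v)) := by rw [hz]; group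

theorem isHilbertSpaceTensorCategory_corep [Nontrivial H] (B : BraidedMultiplicativeUnitary H L) :
    B.corep.IsHilbertSpaceTensorCategory where
  id_mem _ := id_mem_intertwiner _
  comp_mem _ _ _ _ _ ha hb := comp_mem_intertwiner hb ha
  zero_mem _ _ := (intertwinerSubmodule _ _).zero_mem
  add_mem _ _ _ _ ha hb := (intertwinerSubmodule _ _).add_mem ha hb
  smul_mem _ _ c _ ha := (intertwinerSubmodule _ _).smul_mem c ha
  adjoint_mem _ _ _ ha := adjoint_mem_intertwiner ha
  weakly_closed _ _ := (isClosed_setOf_intertwines _ _).inter (isClosed_setOf_intertwines _ _)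
  eq_of_id_mem _ _ h := eq_of_id_mem_intertwiner h
  isObj_triv _ _ _ _ := isRep_ofRightRep_one
  hom_triv a := ⟨Intertwines.one _, Intertwines.one _⟩
  isObj_tensor h₁ h₂ := h₁.tensor h₂
  map_mem _ h₂ _ h₂' _ _ ha hb := map_mem_intertwiner h₂.hasBraiding h₂'.hasBraiding ha hb
  tensor_triv K₁ K₂ := by
    intros
    exact (tensorRep_ofRightRep 1 1).trans (by rw [leg13_one, leg23_one, mul_one]; rfl)
  assoc_mem _ h₂ h₃ := assoc_mem_intertwiner h₂.hasBraiding h₃.hasBraiding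
  leftUnit_mem _ := tmul_mem_intertwiner_left _ _
  rightUnit_mem _ := tmul_mem_intertwiner_right _ _
  cancel_right _ _ _ _ h := mem_intertwiner_of_map_id h
  cancel_left h₁ h₂ _ _ h := mem_intertwiner_of_id_map h₁.hasBraiding h₂.hasBraiding h

theorem isNaturalRightAbsorber_absorber [Nontrivial H] (B : BraidedMultiplicativeUnitary H L) :
    B.corep.IsNaturalRightAbsorber B.absorber (fun x => B.absorbing x) where
  isObj := isRep_regularRep.tensor isRep_braidedRegularRep
  mem_hom hx := toOp_absorbing_mem_intertwiner hx
  natural _ _ _ ha := absorbing_natural ha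
  tensor _ h₂ := absorbing_tensorRep h₂.hasBraiding

end

end BraidedMultiplicativeUnitary

theorem mainTheorem2_general {H L : Type u}
    [NormedAddCommGroup H] [InnerProductSpace ℂ H] [Nontrivial H]
    [NormedAddCommGroup L] [InnerProductSpace ℂ L]
    (B : BraidedMultiplicativeUnitary H L) :
    B.corep.IsHilbertSpaceTensorCategory ∧
      B.corep.IsNaturalRightAbsorber B.absorber (fun x => B.absorbing x) :=
  ⟨B.isHilbertSpaceTensorCategory_corep, B.isNaturalRightAbsorber_absorber⟩

theorem mainTheorem2 {H L : Type u}
    [NormedAddCommGroup H] [InnerProductSpace ℂ H] [CompleteSpace H] [Nontrivial H]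
    [NormedAddCommGroup L] [InnerProductSpace ℂ L] [CompleteSpace L]
    (B : BraidedMultiplicativeUnitary H L) :
    B.corep.IsHilbertSpaceTensorCategory ∧
      B.corep.IsNaturalRightAbsorber B.absorber (fun x => B.absorbing x) :=
  mainTheorem2_general B
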